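/- **Proposition 3.4 (stability of solutions).** Fix $T>0$ and $\gamma=(\gamma_1,\gamma_2)\in(\frac12,1]^2$. For a function $f$ on $[0,T]^2$ with values in a normed space $E$, write $\square_{s,t}f=f(t_1,t_2)-f(t_1,s_2)-f(s_1,t_2)+f(s_1,s_2)$ and $$[f]_\gamma=\sup\frac{|f(t_1,s_2)-f(s_1,s_2)|_E}{|t_1-s_1|^{\gamma_1}}+\sup\frac{|f(s_1,t_2)-f(s_1,s_2)|_E}{|t_2-s_2|^{\gamma_2}}+\sup\frac{|\square_{s,t}f|_E}{|t_1-s_1|^{\gamma_1}|t_2-s_2|^{\gamma_2}},\qquad \|f\|_{C^\gamma_tE}=|f(0,0)|_E+[f]_\gamma,$$ the suprema being over $s,t\in[0,T]^2$ for which the respective denominator is nonzero. Let $C^\gamma_tE$ be the space where this norm is finite; for $E=\mathbb R^d$ write $C^\gamma_t$ and $\|\cdot\|_\gamma$. For $\eta\in(0,1)$ let $C^{2+\eta}_x$ be the space of $C^2$ maps $f:\mathbb R^d\to\mathbb R^d$ with $\|f\|_\infty+\|Df\|_\infty+\|D^2f\|_\infty+[D^2f]_{\eta}<\infty$, where $[\cdot]_\eta$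 is the global $\eta$-Hölder seminorm and derivatives are measured in operator norm. Consider $d\in\mathbb N$ and $\eta\in(0,1)$ with $(1+\eta)\gamma_i>1$ for $i=1,2$. We say that $\theta\in C^\gamma_t$ is a solution driven by $(A,\xi)$, where $A\in C^\gamma_tC^{2+\eta}_x$ and $\xi\in C^\gamma_t$ satisfies $\square_{s,t}\xi=0$ for all $s,t\in[0,T]^2$ with $s_1<t_1$ and $s_2<t_2$, if $$\theta_t=\xi_t+\int_0^tA(ds,\theta_s),\qquad t\in[0,T]^2,$$ where the 2D nonlinear Young integral is the limit $\lim_{|\mathcal P|\to0}\sum_{[u,v]\in\mathcal P}\square_{u,v}A(\theta_u)$ over grid partitions $\mathcal P=\mathcal P^1\times\mathcal P^2$ of $[0,t_1]\times[0,t_2]$ (and the existence of this limit is part of the notion of solution). 1. For every $M>0$ there is a constant $C$ depending only on $\gamma,M,T$ such that, for all such $d,\eta$ and all solutions $\theta,\tilde\theta$ driven by $(A,\xi)$ and $(\tilde A,\tilde\xi)$ respectively with $$\|\theta\|_\gamma\vee\|\tilde\theta\|_\gamma\vee\|A\|_{C^\gamma_tC^{2+\eta}_x}\vee\|\tilde A\|_{C^\gamma_tC^{2+\eta}_x}\le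 M,$$ one has $$[\theta-\tilde\theta]_\gamma\le C\left(\|\xi-\tilde\xi\|_\gamma+\|A-\tilde A\|_{C^\gamma_tC^{2+\eta}_x}\right).$$ 2. For all such $d,\eta$ the solution map $(A,\xi)\mapsto\theta$ is continuous: if $\theta$ is a solution driven by $(A,\xi)$, then for every $\varepsilon>0$ there is $\delta>0$ such that every solution $\tilde\theta$ driven by a pair $(\tilde A,\tilde\xi)$ with $\|A-\tilde A\|_{C^\gamma_tC^{2+\eta}_x}+\|\xi-\tilde\xi\|_\gamma<\delta$ satisfies $\|\theta-\tilde\theta\|_\gamma<\varepsilon$. (In particular the solution driven by $(A,\xi)$ is unique.) -/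

import Mathlib

open scoped NNReal ENNReal

noncomputable section

/-- The increment of `f` over the rectangle `[s₁, t₁] × [s₂, t₂]`. -/
def rectIncr {V : Type*} [AddCommGroup V] (f : ℝ → ℝ → V) (s₁ s₂ t₁ t₂ : ℝ) : V :=
  f t₁ t₂ - f t₁ s₂ - f s₁ t₂ + f s₁ s₂

/-!
Two-parameter Hölder norms on the square `[0, T]²` of functions with values in a normed space.
The norm of the target space is passed as an extended-valued function `N` (infinite outside the
space), so that the same definition serves for values in `ℝ^d` and in `C^{2+η}(ℝ^d; ℝ^d)`.
Functions are total, but only their values on the square enter.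
-/

/-- The seminorm `[f]_{(1,0),γ}` on `[0, T]²`. -/
def holderSeminorm10 {V : Type*} [AddCommGroup V] (N : V → ℝ≥0∞) (T γ₁ : ℝ)
    (f : ℝ → ℝ → V) : ℝ≥0∞ :=
  ⨆ (s₁ ∈ Set.Icc 0 T) (t₁ ∈ Set.Icc 0 T) (s₂ ∈ Set.Icc 0 T) (_ : s₁ ≠ t₁),
    N (f t₁ s₂ - f s₁ s₂) / ENNReal.ofReal (|t₁ - s₁| ^ γ₁)

/-- The seminorm `[f]_{(0,1),γ}` on `[0, T]²`. -/
def holderSeminorm01 {V : Type*} [AddCommGroup V] (N : V → ℝ≥0∞) (T γ₂ : ℝ)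
    (f : ℝ → ℝ → V) : ℝ≥0∞ :=
  ⨆ (s₁ ∈ Set.Icc 0 T) (s₂ ∈ Set.Icc 0 T) (t₂ ∈ Set.Icc 0 T) (_ : s₂ ≠ t₂),
    N (f s₁ t₂ - f s₁ s₂) / ENNReal.ofReal (|t₂ - s₂| ^ γ₂)

/-- The seminorm `[f]_{(1,1),γ}` on `[0, T]²`. -/
def holderSeminorm11 {V : Type*} [AddCommGroup V] (N : V → ℝ≥0∞) (T γ₁ γ₂ : ℝ)
    (f : ℝ → ℝ → V) : ℝ≥0∞ :=
  ⨆ (s₁ ∈ Set.Icc 0 T) (s₂ ∈ Set.Icc 0 T) (t₁ ∈ Set.Icc 0 T) (t₂ ∈ Set.Icc 0 T)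
    (_ : s₁ ≠ t₁) (_ : s₂ ≠ t₂),
    N (rectIncr f s₁ s₂ t₁ t₂) / ENNReal.ofReal (|t₁ - s₁| ^ γ₁ * |t₂ - s₂| ^ γ₂)

/-- The seminorm `[f]_γ = [f]_{(1,0),γ} + [f]_{(0,1),γ} + [f]_{(1,1),γ}` on `[0, T]²`. -/
def holderSeminorm {V : Type*} [AddCommGroup V] (N : V → ℝ≥0∞) (T γ₁ γ₂ : ℝ)
    (f : ℝ → ℝ → V) : ℝ≥0∞ :=
  holderSeminorm10 N T γ₁ f + holderSeminorm01 N T γ₂ f + holderSeminorm11 N T γ₁ γ₂ f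

/-- The norm `|f(0,0)| + [f]_γ` on `[0, T]²`; the Hölder space is the set where it is finite. -/
def holderNorm {V : Type*} [AddCommGroup V] (N : V → ℝ≥0∞) (T γ₁ γ₂ : ℝ)
    (f : ℝ → ℝ → V) : ℝ≥0∞ :=
  N (f 0 0) + holderSeminorm N T γ₁ γ₂ f

/-- The seminorm `[f]_γ` of an `ℝ^d`-valued function. -/
def pathSeminorm {d : ℕ} (T γ₁ γ₂ : ℝ) (f : ℝ → ℝ → EuclideanSpace ℝ (Fin d)) : ℝ≥0∞ :=
  holderSeminorm (fun x => ‖x‖ₑ) T γ₁ γ₂ f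

/-- The norm `‖f‖_γ` of an `ℝ^d`-valued function. -/
def pathNorm {d : ℕ} (T γ₁ γ₂ : ℝ) (f : ℝ → ℝ → EuclideanSpace ℝ (Fin d)) : ℝ≥0∞ :=
  holderNorm (fun x => ‖x‖ₑ) T γ₁ γ₂ f

open scoped Classical in
/-- The norm of the space `C^{2+η}` of bounded twice continuously differentiable maps with bounded
derivatives and globally `η`-Hölder second derivative:
`‖f‖_∞ + ‖Df‖_∞ + ‖D²f‖_∞ + [D²f]_η`, and infinity if `f` is not `C²`. -/
def spaceNorm {d : ℕ} (η : ℝ≥0) (f : EuclideanSpace ℝ (Fin d) → EuclideanSpace ℝ (Fin d)) :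
    ℝ≥0∞ :=
  if ContDiff ℝ 2 f then
    (∑ k ∈ Finset.range 3, ⨆ x, ‖iteratedFDeriv ℝ k f x‖ₑ) + eHolderNorm η (iteratedFDeriv ℝ 2 f)
  else ⊤

/-- The norm of the driver `A` in `C^γ_t C^{2+η}_x`. -/
def driverNorm {d : ℕ} (T γ₁ γ₂ : ℝ) (η : ℝ≥0)
    (A : ℝ → ℝ → EuclideanSpace ℝ (Fin d) → EuclideanSpace ℝ (Fin d)) : ℝ≥0∞ :=
  holderNorm (spaceNorm η) T γ₁ γ₂ A

/-- A finite partition `a = x₀ ≤ x₁ ≤ … ≤ xₙ = b` of `[a, b]`. Repeated points are harmless, since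
a degenerate rectangle has zero increment. -/
structure IntervalPartition (a b : ℝ) where
  n : ℕ
  pt : ℕ → ℝ
  mono : Monotone pt
  pt_zero : pt 0 = a
  pt_n : pt n = b

/-- All cells of the partition have length at most `δ`. -/
def IntervalPartition.MeshLE {a b : ℝ} (P : IntervalPartition a b) (δ : ℝ) : Prop :=
  ∀ i < P.n, P.pt (i + 1) - P.pt i ≤ δ

/-- The sum of `□_{u,v} A (y_u)` over the cells `[u, v]` of the grid `P × Q`. -/
def nlySum {d : ℕ} (A : ℝ → ℝ → EuclideanSpace ℝ (Fin d) → EuclideanSpace ℝ (Fin d))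
    (y : ℝ → ℝ → EuclideanSpace ℝ (Fin d)) {a₁ b₁ a₂ b₂ : ℝ}
    (P : IntervalPartition a₁ b₁) (Q : IntervalPartition a₂ b₂) : EuclideanSpace ℝ (Fin d) :=
  ∑ i ∈ Finset.range P.n, ∑ j ∈ Finset.range Q.n,
    rectIncr A (P.pt i) (Q.pt j) (P.pt (i + 1)) (Q.pt (j + 1)) (y (P.pt i) (Q.pt j))

/-- The two-dimensional nonlinear Young integral `∫_0^t A(ds, y_s)` exists and equals `I`: the sums
over grid partitions of `[0, t₁] × [0, t₂]` converge to `I` as the mesh tends to zero. -/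
def HasNLYIntegral {d : ℕ} (A : ℝ → ℝ → EuclideanSpace ℝ (Fin d) → EuclideanSpace ℝ (Fin d))
    (y : ℝ → ℝ → EuclideanSpace ℝ (Fin d)) (t₁ t₂ : ℝ) (I : EuclideanSpace ℝ (Fin d)) : Prop :=
  ∀ ε > 0, ∃ δ > 0, ∀ (P : IntervalPartition 0 t₁) (Q : IntervalPartition 0 t₂),
    P.MeshLE δ → Q.MeshLE δ → ‖nlySum A y P Q - I‖ < ε

/-- `θ ∈ C^γ_t` solves `θ_t = ξ_t + ∫_0^t A(ds, θ_s)` on `[0, T]²`, where `A ∈ C^γ_t C^{2+η}_x` and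
`ξ ∈ C^γ_t` has vanishing rectangular increments. -/
structure IsNLYSolution {d : ℕ} (T γ₁ γ₂ : ℝ) (η : ℝ≥0)
    (A : ℝ → ℝ → EuclideanSpace ℝ (Fin d) → EuclideanSpace ℝ (Fin d))
    (ξ θ : ℝ → ℝ → EuclideanSpace ℝ (Fin d)) : Prop where
  driver_mem : driverNorm T γ₁ γ₂ η A < ⊤
  boundary_mem : pathNorm T γ₁ γ₂ ξ < ⊤
  boundary_rect : ∀ s₁ ∈ Set.Icc 0 T, ∀ s₂ ∈ Set.Icc 0 T, ∀ t₁ ∈ Set.Icc 0 T, ∀ t₂ ∈ Set.Icc 0 T,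
    s₁ < t₁ → s₂ < t₂ → rectIncr ξ s₁ s₂ t₁ t₂ = 0
  sol_mem : pathNorm T γ₁ γ₂ θ < ⊤
  eqn : ∀ t₁ ∈ Set.Icc 0 T, ∀ t₂ ∈ Set.Icc 0 T,
    HasNLYIntegral A θ t₁ t₂ (θ t₁ t₂ - ξ t₁ t₂)

end

/-! ### Partitions, dyadic sums and sewing -/

/-! Write `ψ = θ' - θ`. Since `ξ` has no rectangular increments, those of `θ` are limits of dyadic
sums of `□A(θ)`, so those of `ψ` are, up to sign, limits of dyadic sums of the germ `□A(θ) - □A'(θ')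
= □(A - A')(θ) - (□A'(θ') - □A'(θ))`. On the axes the integral vanishes, so `ψ` equals `ξ' - ξ`
there.

A two-parameter sewing estimate (`norm_dyadic_sum_sum_le`) bounds such sums by the size of the germ
and its bisection defects in the first, the second and both variables. The sewing exponents are `γᵢ
+ 1/2 > 1`. The mixed defect contains a third difference of `A'`, where the Hölder exponent `η` may
be placed on the increment of `θ` in either variable. The better of the two choices is at most the
geometric mean, of order `√r₁ √r₂` because `(1 + η) γᵢ ≥ 1` (`mixed_rpow_le`). These exponents do
not involve `η`, which makes the constants uniform in `η` and `d`.

On a strip `[a, b] × [0, T]` let `X` control `ψ` on the left edge, `D` the data, and `Y` the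
rectangular increments of `ψ`. The sup norm of `ψ` and its increments in the second variable see `Y`
only through a rectangle of width at most `b - a`; defects involving the first variable have a spare
factor `√(b - a)` from sewing. Hence `Y` enters only with that small factor (`local_rectBound`) and
is absorbed on thin strips (`rectBound_of_small`). The required width depends only on `T`, `γ` and
the a priori bounds, so finitely many strips cover the square (`extend`, `stability`).

One mixed term is quadratic in `ψ`; one of its factors is bounded by a crude constant `M'`. In the
first claim `M'` comes from the bound on both solutions. In the second claim no uniform bound on
`θ'` is available. However, the growth factor over one strip, `extConst`, does not depend on `M'`,
only the strip width does. A bootstrap therefore works (`stability_of_close`): as long as the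
rectangular constant of `ψ` is at most 1, `M'` can be replaced by `2 + T`, the constant is in fact
`O(D)`, and one more strip keeps it at most 1 when `D` is small. -/

namespace IntervalPartition

/-- The sum of a two-point function over the cells of a partition. -/
def sum {V : Type*} [AddCommMonoid V] {a b : ℝ} (P : IntervalPartition a b) (Ξ : ℝ → ℝ → V) : V :=
  ∑ i ∈ Finset.range P.n, Ξ (P.pt i) (P.pt (i + 1))

/-- The partition of `[a, b]` with a single cell. -/
def single {a b : ℝ} (h : a ≤ b) : IntervalPartition a b where
  n := 1
  pt i := if i = 0 then a else b
  mono := by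
    intro i j hij
    by_cases hi : i = 0
    · by_cases hj : j = 0 <;> simp [hi, hj, h]
    · have hj : j ≠ 0 := by omega
      simp [hi, hj]
  pt_zero := by simp
  pt_n := by simp

/-- The concatenation of two partitions. -/
def append {a b c : ℝ} (P : IntervalPartition a b) (Q : IntervalPartition b c) :
    IntervalPartition a c where
  n := P.n + Q.n
  pt i := if i ≤ P.n then P.pt i else Q.pt (i - P.n)
  mono := by
    intro i j hij
    by_cases hj : j ≤ P.n
    · have hi : i ≤ P.n := hij.trans hj
      simpa [hi, hj] using P.mono hij
    · by_cases hi : i ≤ P.n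
      · simp only [hi, hj, if_true, if_false]
        calc P.pt i ≤ P.pt P.n := P.mono hi
          _ = Q.pt 0 := by rw [P.pt_n, Q.pt_zero]
          _ ≤ _ := Q.mono (Nat.zero_le _)
      · simpa [hi, hj] using Q.mono (Nat.sub_le_sub_right hij P.n)
  pt_zero := by simp [P.pt_zero]
  pt_n := by
    by_cases hQ : Q.n = 0
    · have h1 := Q.pt_n
      rw [hQ, Q.pt_zero] at h1
      simp [hQ, P.pt_n, h1]
    · have : ¬ (P.n + Q.n ≤ P.n) := by omega
      simp [hQ, Q.pt_n]

theorem append_pt_add {a b c : ℝ} (P : IntervalPartition a b) (Q : IntervalPartition b c) (i : ℕ) :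
    (P.append Q).pt (P.n + i) = Q.pt i := by
  by_cases hi : i = 0
  · simp [append, hi, P.pt_n, Q.pt_zero]
  · simp [append, hi]

theorem append_pt_of_le {a b c : ℝ} (P : IntervalPartition a b) (Q : IntervalPartition b c) {i : ℕ}
    (hi : i ≤ P.n) : (P.append Q).pt i = P.pt i := by
  simp [append, hi]

theorem sum_append {V : Type*} [AddCommMonoid V] {a b c : ℝ} (P : IntervalPartition a b)
    (Q : IntervalPartition b c) (Ξ : ℝ → ℝ → V) :
    (P.append Q).sum Ξ = P.sum Ξ + Q.sum Ξ := by
  have hn : (P.append Q).n = P.n + Q.n := rfl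
  rw [sum, hn, Finset.sum_range_add]
  congr 1
  · refine Finset.sum_congr rfl fun i hi => ?_
    have hi' := Finset.mem_range.1 hi
    rw [append_pt_of_le P Q hi'.le, append_pt_of_le P Q hi']
  · refine Finset.sum_congr rfl fun i _ => ?_
    rw [append_pt_add, add_assoc, append_pt_add]

theorem MeshLE.append {a b c δ : ℝ} {P : IntervalPartition a b} {Q : IntervalPartition b c}
    (hP : P.MeshLE δ) (hQ : Q.MeshLE δ) : (P.append Q).MeshLE δ := by
  intro i hi
  by_cases hiP : i < P.n
  · rw [append_pt_of_le P Q hiP.le, append_pt_of_le P Q hiP]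
    exact hP i hiP
  · obtain ⟨k, rfl⟩ := Nat.exists_eq_add_of_le (not_lt.1 hiP)
    have hi' : P.n + k < P.n + Q.n := hi
    rw [append_pt_add, add_assoc, append_pt_add]
    exact hQ k (by omega)

theorem MeshLE.mono {a b δ δ' : ℝ} {P : IntervalPartition a b} (hP : P.MeshLE δ) (h : δ ≤ δ') :
    P.MeshLE δ' := fun i hi => (hP i hi).trans h

/-- The partition of `[a, b]` into `2 ^ n` cells of equal length. -/
noncomputable def dyadic : (n : ℕ) → {a b : ℝ} → a ≤ b → IntervalPartition a b
  | 0, _, _, h => single h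
  | n + 1, a, b, h =>
    (dyadic n (show a ≤ (a + b) / 2 by linarith)).append
      (dyadic n (show (a + b) / 2 ≤ b by linarith))

theorem dyadic_meshLE (n : ℕ) : ∀ {a b : ℝ} (h : a ≤ b), (dyadic n h).MeshLE ((b - a) / 2 ^ n) := by
  induction n with
  | zero =>
    intro a b h i hi
    have hi0 : i = 0 := by
      have : i < 1 := hi
      omega
    simp [hi0, dyadic, single]
  | succ n ih =>
    intro a b h
    refine MeshLE.append ((ih _).mono (le_of_eq ?_)) ((ih _).mono (le_of_eq ?_)) <;>
      field_simp <;> ring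

theorem exists_dyadic_meshLE {a b δ : ℝ} (h : a ≤ b) (hδ : 0 < δ) :
    ∃ n₀, ∀ n ≥ n₀, (dyadic n h).MeshLE δ := by
  have ht : Filter.Tendsto (fun n : ℕ => (b - a) / (2 : ℝ) ^ n) Filter.atTop (nhds 0) :=
    tendsto_const_nhds.div_atTop (tendsto_pow_atTop_atTop_of_one_lt one_lt_two)
  obtain ⟨n₀, hn₀⟩ := Filter.eventually_atTop.1 (ht.eventually (ge_mem_nhds hδ))
  exact ⟨n₀, fun n hn => (dyadic_meshLE n h).mono (hn₀ n hn)⟩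

theorem sum_single {V : Type*} [AddCommMonoid V] {a b : ℝ} (h : a ≤ b) (Ξ : ℝ → ℝ → V) :
    (single h).sum Ξ = Ξ a b := by
  simp [sum, single]

theorem sum_sub {V : Type*} [AddCommGroup V] {a b : ℝ} (P : IntervalPartition a b)
    (Ξ Ξ' : ℝ → ℝ → V) : P.sum (fun s t => Ξ s t - Ξ' s t) = P.sum Ξ - P.sum Ξ' := by
  simp [sum, Finset.sum_sub_distrib]

/-- The constant of the one-dimensional sewing lemma. -/
noncomputable def sewingConst (β : ℝ) : ℝ := 1 / (1 - (2 : ℝ) ^ (1 - β))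

theorem two_rpow_lt_one {β : ℝ} (hβ : 1 < β) : (2 : ℝ) ^ (1 - β) < 1 :=
  Real.rpow_lt_one_of_one_lt_of_neg one_lt_two (by linarith)

theorem sewingConst_pos {β : ℝ} (hβ : 1 < β) : 0 < sewingConst β :=
  one_div_pos.2 (sub_pos.2 (two_rpow_lt_one hβ))

/-- The fixed-point relation of the geometric series of ratio `2 ^ (1 - β)`: two halves each
contribute the factor `2 ^ (-β)`, and the new defect contributes 1. -/
theorem sewingConst_eq {β : ℝ} (hβ : 1 < β) :
    2 * (sewingConst β * (2 : ℝ) ^ (-β)) + 1 = sewingConst β := by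
  have h : (2 : ℝ) ^ (1 - β) = 2 * (2 : ℝ) ^ (-β) := by
    rw [sub_eq_add_neg, Real.rpow_add two_pos, Real.rpow_one]
  have h1 := two_rpow_lt_one hβ
  rw [h] at h1
  have h2 : 1 - 2 * (2 : ℝ) ^ (-β) ≠ 0 := by linarith
  rw [sewingConst, h]
  field_simp
  ring

variable {E : Type*} [NormedAddCommGroup E]

/-- One-dimensional sewing estimate along dyadic partitions. -/
theorem norm_dyadic_sum_sub_le {β c : ℝ} (hβ : 1 < β) {Ξ : ℝ → ℝ → E} (n : ℕ) :
    ∀ {a b : ℝ} (h : a ≤ b),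
    (∀ s t, a ≤ s → s ≤ t → t ≤ b →
      ‖Ξ s t - Ξ s ((s + t) / 2) - Ξ ((s + t) / 2) t‖ ≤ c * (t - s) ^ β) →
    ‖(dyadic n h).sum Ξ - Ξ a b‖ ≤ sewingConst β * (c * (b - a) ^ β) := by
  induction n with
  | zero =>
    intro a b h hΞ
    -- The sign of `c` is not assumed; nonnegativity of the error term is read off from the defect
    -- bound itself.
    have h0 := (norm_nonneg _).trans (hΞ a b le_rfl h le_rfl)
    simpa [dyadic, sum_single] using mul_nonneg (sewingConst_pos hβ).le h0
  | succ n ih =>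
    intro a b h hΞ
    have h1 : a ≤ (a + b) / 2 := by linarith
    have h2 : (a + b) / 2 ≤ b := by linarith
    have e1 := ih h1 (fun s t hs hst ht => hΞ s t hs hst (ht.trans h2))
    have e2 := ih h2 (fun s t hs hst ht => hΞ s t (h1.trans hs) hst ht)
    have e3 := hΞ a b le_rfl h le_rfl
    have hhalf : ((b - a) / 2) ^ β = (b - a) ^ β * (2 : ℝ) ^ (-β) := by
      rw [Real.div_rpow (by linarith) two_pos.le, Real.rpow_neg two_pos.le, div_eq_mul_inv]
    rw [show (a + b) / 2 - a = (b - a) / 2 by ring, hhalf] at e1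
    rw [show b - (a + b) / 2 = (b - a) / 2 by ring, hhalf] at e2
    have key : (dyadic (n + 1) h).sum Ξ - Ξ a b =
        ((dyadic n h1).sum Ξ - Ξ a ((a + b) / 2)) + ((dyadic n h2).sum Ξ - Ξ ((a + b) / 2) b)
          - (Ξ a b - Ξ a ((a + b) / 2) - Ξ ((a + b) / 2) b) := by
      rw [show (dyadic (n + 1) h).sum Ξ = (dyadic n h1).sum Ξ + (dyadic n h2).sum Ξ from
        sum_append _ _ _]
      abel
    rw [key]
    calc _ ≤ _ := norm_sub_le _ _
      _ ≤ _ := add_le_add (norm_add_le _ _) le_rfl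
      _ ≤ _ := add_le_add (add_le_add e1 e2) e3
      _ = (2 * (sewingConst β * (2 : ℝ) ^ (-β)) + 1) * (c * (b - a) ^ β) := by ring
      _ = _ := by rw [sewingConst_eq hβ]

theorem norm_dyadic_sum_le {β c : ℝ} (hβ : 1 < β) {Ξ : ℝ → ℝ → E} (n : ℕ)
    {a b : ℝ} (h : a ≤ b)
    (hΞ : ∀ s t, a ≤ s → s ≤ t → t ≤ b →
      ‖Ξ s t - Ξ s ((s + t) / 2) - Ξ ((s + t) / 2) t‖ ≤ c * (t - s) ^ β) :
    ‖(dyadic n h).sum Ξ‖ ≤ ‖Ξ a b‖ + sewingConst β * (c * (b - a) ^ β) := by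
  have h1 := norm_dyadic_sum_sub_le hβ n h hΞ
  have h2 := norm_add_le (Ξ a b) ((dyadic n h).sum Ξ - Ξ a b)
  rw [add_sub_cancel] at h2
  linarith

/-- Two-dimensional sewing estimate along dyadic grids. The germ is `Z s₁ t₁ s₂ t₂`. -/
theorem norm_dyadic_sum_sum_le {β₁ β₂ c₀ c₁ c₂ c₁₂ : ℝ} (hβ₁ : 1 < β₁) (hβ₂ : 1 < β₂)
    {Z : ℝ → ℝ → ℝ → ℝ → E} (n m : ℕ) {a₁ b₁ a₂ b₂ : ℝ} (h₁ : a₁ ≤ b₁) (h₂ : a₂ ≤ b₂)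
    (hZ₀ : ‖Z a₁ b₁ a₂ b₂‖ ≤ c₀)
    (hZ₁ : ∀ s t, a₁ ≤ s → s ≤ t → t ≤ b₁ →
      ‖Z s t a₂ b₂ - Z s ((s + t) / 2) a₂ b₂ - Z ((s + t) / 2) t a₂ b₂‖ ≤ c₁ * (t - s) ^ β₁)
    (hZ₂ : ∀ s t, a₂ ≤ s → s ≤ t → t ≤ b₂ →
      ‖Z a₁ b₁ s t - Z a₁ b₁ s ((s + t) / 2) - Z a₁ b₁ ((s + t) / 2) t‖ ≤ c₂ * (t - s) ^ β₂)
    (hZ₁₂ : ∀ s₁ t₁ s₂ t₂, a₁ ≤ s₁ → s₁ ≤ t₁ → t₁ ≤ b₁ → a₂ ≤ s₂ → s₂ ≤ t₂ → t₂ ≤ b₂ →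
      ‖(Z s₁ t₁ s₂ t₂ - Z s₁ ((s₁ + t₁) / 2) s₂ t₂ - Z ((s₁ + t₁) / 2) t₁ s₂ t₂)
        - (Z s₁ t₁ s₂ ((s₂ + t₂) / 2) - Z s₁ ((s₁ + t₁) / 2) s₂ ((s₂ + t₂) / 2)
            - Z ((s₁ + t₁) / 2) t₁ s₂ ((s₂ + t₂) / 2))
        - (Z s₁ t₁ ((s₂ + t₂) / 2) t₂ - Z s₁ ((s₁ + t₁) / 2) ((s₂ + t₂) / 2) t₂
            - Z ((s₁ + t₁) / 2) t₁ ((s₂ + t₂) / 2) t₂)‖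
        ≤ c₁₂ * (t₁ - s₁) ^ β₁ * (t₂ - s₂) ^ β₂) :
    ‖(dyadic n h₁).sum fun s₁ t₁ => (dyadic m h₂).sum fun s₂ t₂ => Z s₁ t₁ s₂ t₂‖ ≤
      c₀ + sewingConst β₂ * (c₂ * (b₂ - a₂) ^ β₂)
        + sewingConst β₁ * ((c₁ + sewingConst β₂ * (c₁₂ * (b₂ - a₂) ^ β₂)) * (b₁ - a₁) ^ β₁) := by
  have e0 := norm_dyadic_sum_le hβ₂ m h₂ (Ξ := fun s t => Z a₁ b₁ s t) hZ₂
  -- The outer germ is the inner dyadic sum. Its value on the whole interval is bounded by `e0`, and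
  -- its defect is the inner sum of first-variable defects, to which the one-dimensional estimate
  -- applies again.
  have e1 := norm_dyadic_sum_le (c := c₁ + sewingConst β₂ * (c₁₂ * (b₂ - a₂) ^ β₂)) hβ₁ n h₁
    (Ξ := fun s₁ t₁ => (dyadic m h₂).sum fun s₂ t₂ => Z s₁ t₁ s₂ t₂) ?_
  · linarith
  · intro s t hs hst ht
    have e2 := norm_dyadic_sum_le (c := c₁₂ * (t - s) ^ β₁) hβ₂ m h₂
      (Ξ := fun s₂ t₂ => Z s t s₂ t₂ - Z s ((s + t) / 2) s₂ t₂ - Z ((s + t) / 2) t s₂ t₂)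
      (fun s₂ t₂ hs₂ hst₂ ht₂ => hZ₁₂ s t s₂ t₂ hs hst ht hs₂ hst₂ ht₂)
    rw [sum_sub _ (fun s₂ t₂ => Z s t s₂ t₂ - Z s ((s + t) / 2) s₂ t₂), sum_sub] at e2
    refine e2.trans ?_
    have := hZ₁ s t hs hst ht
    calc _ ≤ c₁ * (t - s) ^ β₁ + _ := add_le_add this le_rfl
      _ = _ := by ring

end IntervalPartition

/-! ### Bounds on finite differences and composition estimates -/

/-- The finite differences of `f` up to order three are those of a map whose `C^{2+η}` norm is at
most `N`. -/
structure DiffBound {E F : Type*} [NormedAddCommGroup E] [NormedAddCommGroup F] (η N : ℝ)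
    (f : E → F) : Prop where
  zero : ∀ x, ‖f x‖ ≤ N
  one : ∀ x p, ‖f (x + p) - f x‖ ≤ N * ‖p‖
  two : ∀ x p q, ‖f (x + p + q) - f (x + p) - f (x + q) + f x‖ ≤ N * ‖p‖ * ‖q‖
  three : ∀ x p q r, ‖(f (x + r + p + q) - f (x + p + q)) - (f (x + r + p) - f (x + p))
    - (f (x + r + q) - f (x + q)) + (f (x + r) - f x)‖ ≤ N * ‖r‖ ^ η * ‖p‖ * ‖q‖

namespace DiffBound

variable {E F : Type*} [NormedAddCommGroup E] [NormedAddCommGroup F] {η N N' : ℝ} {f g : E → F}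

theorem nonneg (hf : DiffBound η N f) : 0 ≤ N := (norm_nonneg _).trans (hf.zero 0)

theorem mono (hf : DiffBound η N f) (h : N ≤ N') : DiffBound η N' f where
  zero x := (hf.zero x).trans h
  one x p := (hf.one x p).trans (by gcongr)
  two x p q := (hf.two x p q).trans (by gcongr)
  three x p q r := (hf.three x p q r).trans (by gcongr)

theorem sub (hf : DiffBound η N f) (hg : DiffBound η N' g) : DiffBound η (N + N') (f - g) where
  zero x := (norm_sub_le _ _).trans (add_le_add (hf.zero x) (hg.zero x))
  one x p := by
    have := (norm_sub_le _ _).trans (add_le_add (hf.one x p) (hg.one x p))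
    rw [← add_mul] at this
    refine le_of_eq_of_le (congrArg norm ?_) this
    simp only [Pi.sub_apply]
    abel
  two x p q := by
    have := (norm_sub_le _ _).trans (add_le_add (hf.two x p q) (hg.two x p q))
    rw [← add_mul, ← add_mul] at this
    refine le_of_eq_of_le (congrArg norm ?_) this
    simp only [Pi.sub_apply]
    abel
  three x p q r := by
    have := (norm_sub_le _ _).trans (add_le_add (hf.three x p q r) (hg.three x p q r))
    rw [← add_mul, ← add_mul, ← add_mul] at this
    refine le_of_eq_of_le (congrArg norm ?_) this
    simp only [Pi.sub_apply]
    abel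

theorem norm_sub_le' (hf : DiffBound η N f) (x y : E) : ‖f y - f x‖ ≤ N * ‖y - x‖ := by
  simpa using hf.one x (y - x)

/-- Rectangular increment of a composition. -/
theorem norm_rect_le (hf : DiffBound η N f) (x₀₀ x₁₀ x₀₁ x₁₁ : E) :
    ‖f x₁₁ - f x₁₀ - f x₀₁ + f x₀₀‖ ≤
      N * (‖x₁₁ - x₁₀ - x₀₁ + x₀₀‖ + ‖x₁₀ - x₀₀‖ * ‖x₀₁ - x₀₀‖) := by
  have h1 := hf.two x₀₀ (x₁₀ - x₀₀) (x₀₁ - x₀₀)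
  have h2 := hf.norm_sub_le' (x₁₀ + x₀₁ - x₀₀) x₁₁
  rw [show x₀₀ + (x₁₀ - x₀₀) + (x₀₁ - x₀₀) = x₁₀ + x₀₁ - x₀₀ by abel,
    add_sub_cancel, add_sub_cancel] at h1
  rw [show x₁₁ - (x₁₀ + x₀₁ - x₀₀) = x₁₁ - x₁₀ - x₀₁ + x₀₀ by abel] at h2
  calc _ = ‖(f x₁₁ - f (x₁₀ + x₀₁ - x₀₀)) + (f (x₁₀ + x₀₁ - x₀₀) - f x₁₀ - f x₀₁ + f x₀₀)‖ :=
        congrArg norm (by abel)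
    _ ≤ _ := (norm_add_le _ _).trans (add_le_add h2 h1)
    _ = _ := by ring

/-- Increment of a difference of compositions. -/
theorem norm_two_point_le (hf : DiffBound η N f) (x₀ x₁ y₀ y₁ : E) :
    ‖(f y₁ - f x₁) - (f y₀ - f x₀)‖ ≤
      N * (‖(y₁ - x₁) - (y₀ - x₀)‖ + ‖x₁ - x₀‖ * ‖y₀ - x₀‖) := by
  have h := hf.norm_rect_le x₀ x₁ y₀ y₁
  refine (le_of_eq_of_le (congrArg norm ?_) h).trans (le_of_eq ?_)
  · abel
  · rw [show y₁ - x₁ - y₀ + x₀ = (y₁ - x₁) - (y₀ - x₀) by abel]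

/-- Rectangular increment of a difference of compositions. -/
theorem norm_rect_sub_le {κ : ℝ} (hf : DiffBound η N f) (x₀₀ x₁₀ x₀₁ x₁₁ p₀₀ p₁₀ p₀₁ p₁₁ : E)
    (hκ₁ : ‖x₁₀ - x₀₀‖ ^ η * ‖x₀₁ - x₀₀‖ ≤ κ ∨ ‖x₁₀ - x₀₀‖ * ‖x₀₁ - x₀₀‖ ^ η ≤ κ) :
    ‖(f (x₁₁ + p₁₁) - f x₁₁) - (f (x₁₀ + p₁₀) - f x₁₀) - (f (x₀₁ + p₀₁) - f x₀₁)
        + (f (x₀₀ + p₀₀) - f x₀₀)‖ ≤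
      N * (‖p₁₁ - p₁₀ - p₀₁ + p₀₀‖ + ‖x₁₁ - x₁₀ - x₀₁ + x₀₀‖ * ‖p₁₁‖ + κ * ‖p₀₀‖
        + ‖p₁₀ - p₀₀‖ * ‖p₀₁ - p₀₀‖ + ‖p₁₀ - p₀₀‖ * ‖x₀₁ - x₀₀‖
        + ‖x₁₀ - x₀₀‖ * ‖p₀₁ - p₀₀‖) := by
  have hN := hf.nonneg
  obtain ⟨u, rfl⟩ : ∃ u, x₁₀ = x₀₀ + u := ⟨x₁₀ - x₀₀, by abel⟩
  obtain ⟨v, rfl⟩ : ∃ v, x₀₁ = x₀₀ + v := ⟨x₀₁ - x₀₀, by abel⟩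
  obtain ⟨w, rfl⟩ : ∃ w, x₁₁ = x₀₀ + u + v + w := ⟨x₁₁ - (x₀₀ + u + v), by abel⟩
  obtain ⟨a, rfl⟩ : ∃ a, p₁₀ = p₀₀ + a := ⟨p₁₀ - p₀₀, by abel⟩
  obtain ⟨b, rfl⟩ : ∃ b, p₀₁ = p₀₀ + b := ⟨p₀₁ - p₀₀, by abel⟩
  obtain ⟨c, rfl⟩ : ∃ c, p₁₁ = p₀₀ + a + b + c := ⟨p₁₁ - (p₀₀ + a + b), by abel⟩
  generalize x₀₀ = x at *
  generalize p₀₀ = p at *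
  have e1 : p + a + b + c - (p + a) - (p + b) + p = c := by abel
  have e2 : x + u + v + w - (x + u) - (x + v) + x = w := by abel
  simp only [add_sub_cancel_left, e1, e2] at hκ₁ ⊢
  -- Six pieces: `h1` and `h2` replace the fourth corners of `x` and `p` by the parallelogram
  -- corners, `h3` is the third difference with constant perturbation `p`, and `h4`, `h5`, `h6`
  -- account for the variation `a`, `b` of the perturbation.
  have h1 := hf.two (x + u + v) w (p + a + b + c)
  have h2 := hf.one (x + u + v + (p + a + b)) c
  have h3 : ‖(f (x + p + u + v) - f (x + u + v)) - (f (x + p + u) - f (x + u))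
    - (f (x + p + v) - f (x + v)) + (f (x + p) - f x)‖ ≤ N * (κ * ‖p‖) := by
    -- A third difference is symmetric in its increments `u`, `v`, `p`, so the exponent `η` can be
    -- put on `u` or on `v`.
    rcases hκ₁ with h | h
    · have := hf.three x v p u
      calc _ = _ := congrArg norm ?_
        _ ≤ _ := this
        _ = N * ((‖u‖ ^ η * ‖v‖) * ‖p‖) := by ring
        _ ≤ _ := by gcongr
      rw [show x + u + v + p = x + p + u + v by abel, show x + v + p = x + p + v by abel,
        show x + u + p = x + p + u by abel]
      abel
    · have := hf.three x u p v
      calc _ = _ := congrArg norm ?_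
        _ ≤ _ := this
        _ = N * ((‖u‖ * ‖v‖ ^ η) * ‖p‖) := by ring
        _ ≤ _ := by gcongr
      rw [show x + v + u + p = x + p + u + v by abel, show x + v + p = x + p + v by abel,
        show x + u + p = x + p + u by abel, show x + v + u = x + u + v by abel]
      abel
  have h4 := hf.two (x + p + u + v) a b
  have h5 := hf.two (x + p + u) a v
  have h6 := hf.two (x + p + v) b u
  calc _ = ‖(f (x + u + v + w + (p + a + b + c)) - f (x + u + v + w)
          - f (x + u + v + (p + a + b + c)) + f (x + u + v))
        + (f (x + u + v + (p + a + b) + c) - f (x + u + v + (p + a + b)))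
        + ((f (x + p + u + v) - f (x + u + v)) - (f (x + p + u) - f (x + u))
    - (f (x + p + v) - f (x + v)) + (f (x + p) - f x))
        + (f (x + p + u + v + a + b) - f (x + p + u + v + a) - f (x + p + u + v + b)
            + f (x + p + u + v))
        + (f (x + p + u + a + v) - f (x + p + u + a) - f (x + p + u + v) + f (x + p + u))
        + (f (x + p + v + b + u) - f (x + p + v + b) - f (x + p + v + u) + f (x + p + v))‖ := by
        rw [show x + u + v + (p + a + b + c) = x + u + v + (p + a + b) + c by abel,
          show x + u + v + (p + a + b) = x + p + u + v + a + b by abel,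
          show x + p + u + a + v = x + p + u + v + a by abel,
          show x + p + v + b + u = x + p + u + v + b by abel,
          show x + p + v + u = x + p + u + v by abel,
          show x + u + (p + a) = x + p + u + a by abel,
          show x + v + (p + b) = x + p + v + b by abel]
        congr 1
        abel
    _ ≤ N * ‖w‖ * ‖p + a + b + c‖ + N * ‖c‖ + N * (κ * ‖p‖) + N * ‖a‖ * ‖b‖ + N * ‖a‖ * ‖v‖
        + N * ‖b‖ * ‖u‖ :=
        norm_add_le_of_le (norm_add_le_of_le (norm_add_le_of_le (norm_add_le_of_le
          (norm_add_le_of_le h1 h2) h3) h4) h5) h6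
    _ = _ := by ring

end DiffBound

/-! ### Finite differences controlled by derivatives -/

section Calculus

variable {E F : Type*} [NormedAddCommGroup E] [NormedSpace ℝ E] [NormedAddCommGroup F]
  [NormedSpace ℝ F]

theorem norm_add_sub_le_of_norm_fderiv_le {f : E → F} {L : ℝ} (hf : Differentiable ℝ f)
    (hL : ∀ x, ‖fderiv ℝ f x‖ ≤ L) (x p : E) : ‖f (x + p) - f x‖ ≤ L * ‖p‖ := by
  simpa using Convex.norm_image_sub_le_of_norm_fderiv_le (s := Set.univ) (fun z _ => hf z)
    (fun z _ => hL z) convex_univ (Set.mem_univ x) (Set.mem_univ (x + p))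

theorem fderiv_comp_add_sub {f : E → F} (hf : Differentiable ℝ f) (x p : E) :
    fderiv ℝ (fun z => f (z + p) - f z) x = fderiv ℝ f (x + p) - fderiv ℝ f x := by
  have h1 : DifferentiableAt ℝ (fun z => f (z + p)) x :=
    (hf (x + p)).comp x (differentiableAt_id.add_const p)
  rw [show (fun z => f (z + p) - f z) = (fun z => f (z + p)) - f from rfl,
    fderiv_sub h1 (hf x), fderiv_comp_add_right]

theorem differentiable_comp_add_sub {f : E → F} (hf : Differentiable ℝ f) (p : E) :
    Differentiable ℝ (fun z => f (z + p) - f z) :=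
  (hf.comp (differentiable_id.add_const p)).sub hf

/-- The mean value inequality twice: once for `fderiv ℝ f`, once for `z ↦ f (z + p) - f z`. -/
theorem norm_second_diff_le {f : E → F} {L : ℝ} (hf : ContDiff ℝ 2 f)
    (hL : ∀ x, ‖fderiv ℝ (fderiv ℝ f) x‖ ≤ L) (x p q : E) :
    ‖f (x + p + q) - f (x + p) - f (x + q) + f x‖ ≤ L * ‖p‖ * ‖q‖ := by
  have hd : Differentiable ℝ f := hf.differentiable two_ne_zero
  have hd' : Differentiable ℝ (fderiv ℝ f) :=
    (hf.fderiv_right (m := 1) (by norm_num)).differentiable one_ne_zero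
  have h := norm_add_sub_le_of_norm_fderiv_le (differentiable_comp_add_sub hd p)
    (L := L * ‖p‖) (fun z => by
      rw [fderiv_comp_add_sub hd]
      exact norm_add_sub_le_of_norm_fderiv_le hd' hL z p) x q
  refine le_of_eq_of_le (congrArg norm ?_) h
  rw [show x + q + p = x + p + q by abel]
  abel

end Calculus

theorem norm_fderiv_fderiv_eq {E F : Type*} [NormedAddCommGroup E] [NormedSpace ℝ E]
    [NormedAddCommGroup F] [NormedSpace ℝ F] (f : E → F) (x : E) :
    ‖fderiv ℝ (fderiv ℝ f) x‖ = ‖iteratedFDeriv ℝ 2 f x‖ := by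
  rw [← norm_iteratedFDeriv_one (fderiv ℝ f), norm_iteratedFDeriv_fderiv]

/-- The third difference is the second difference of `f (· + r) - f`, whose second derivative is at
most `N ‖r‖ ^ η` by Hölder continuity. After this, derivatives are no longer needed. -/
theorem DiffBound.of_spaceNorm_le {d : ℕ} {η : ℝ≥0} {N : ℝ} (hN : 0 ≤ N)
    {f : EuclideanSpace ℝ (Fin d) → EuclideanSpace ℝ (Fin d)}
    (hf : spaceNorm η f ≤ ENNReal.ofReal N) : DiffBound η N f := by
  rw [spaceNorm] at hf
  split_ifs at hf with hc
  swap
  · simp at hf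
  have hk : ∀ k ∈ Finset.range 3, ∀ x, ‖iteratedFDeriv ℝ k f x‖ ≤ N := by
    intro k hk x
    have h1 : ‖iteratedFDeriv ℝ k f x‖ₑ ≤ ENNReal.ofReal N :=
      calc _ ≤ ⨆ x, ‖iteratedFDeriv ℝ k f x‖ₑ := le_iSup (fun x => ‖iteratedFDeriv ℝ k f x‖ₑ) x
        _ ≤ ∑ k ∈ Finset.range 3, ⨆ x, ‖iteratedFDeriv ℝ k f x‖ₑ :=
          Finset.single_le_sum (f := fun k => ⨆ x, ‖iteratedFDeriv ℝ k f x‖ₑ)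
            (fun _ _ => zero_le) hk
        _ ≤ _ := le_self_add.trans hf
    rw [← ofReal_norm] at h1
    exact (ENNReal.ofReal_le_ofReal_iff hN).1 h1
  have hd : Differentiable ℝ f := hc.differentiable two_ne_zero
  have h2 : ∀ x y, ‖iteratedFDeriv ℝ 2 f x - iteratedFDeriv ℝ 2 f y‖ ≤ N * ‖x - y‖ ^ (η : ℝ) := by
    have h3 : eHolderNorm η (iteratedFDeriv ℝ 2 f) ≤ ENNReal.ofReal N := le_add_self.trans hf
    have h4 : MemHolder η (iteratedFDeriv ℝ 2 f) :=
      eHolderNorm_lt_top.1 (h3.trans_lt ENNReal.ofReal_lt_top)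
    intro x y
    have h5 := h4.holderWith.dist_le x y
    have h6 : (nnHolderNorm η (iteratedFDeriv ℝ 2 f) : ℝ) ≤ N := by
      rw [← h4.coe_nnHolderNorm_eq_eHolderNorm] at h3
      have := ENNReal.toReal_mono ENNReal.ofReal_ne_top h3
      simpa [ENNReal.toReal_ofReal hN] using this
    rw [dist_eq_norm, dist_eq_norm] at h5
    exact h5.trans (by gcongr)
  refine ⟨fun x => ?_, fun x p => ?_, fun x p q => ?_, fun x p q r => ?_⟩
  · simpa using hk 0 (by simp) x
  · exact norm_add_sub_le_of_norm_fderiv_le hd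
      (fun z => by simpa [norm_iteratedFDeriv_one] using hk 1 (by simp) z) x p
  · exact norm_second_diff_le hc
      (fun z => by rw [norm_fderiv_fderiv_eq]; exact hk 2 (by simp) z) x p q
  · have hc' : ContDiff ℝ 2 (fun z => f (z + r)) := hc.comp (contDiff_id.add contDiff_const)
    have h := norm_second_diff_le (f := (fun z => f (z + r)) - f) (L := N * ‖r‖ ^ (η : ℝ))
      (hc'.sub hc) (fun z => by
        rw [norm_fderiv_fderiv_eq, iteratedFDeriv_sub_apply (i := 2) hc'.contDiffAt hc.contDiffAt,
          iteratedFDeriv_comp_add_right]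
        simpa using h2 (z + r) z) x p q
    refine le_of_eq_of_le (congrArg norm ?_) h
    simp only [Pi.sub_apply]
    rw [show x + r + p + q = x + p + q + r by abel, show x + r + p = x + p + r by abel,
      show x + r + q = x + q + r by abel]

/-! ### The local estimate on a strip -/

/-! ### Elementary bounds on powers -/

section Rpow

variable {T r e : ℝ}

theorem rpow_le_one_add (hr : 0 ≤ r) (hrT : r ≤ T) (he : 0 ≤ e) (he1 : e ≤ 1) : r ^ e ≤ 1 + T :=
  calc r ^ e ≤ (1 + T) ^ e := by gcongr; linarith
    _ ≤ (1 + T) ^ (1 : ℝ) := Real.rpow_le_rpow_of_exponent_le (by linarith) he1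
    _ = _ := Real.rpow_one _

theorem rpow_add_half (hr : 0 ≤ r) (he : 0 ≤ e) : r ^ (e + 1 / 2) = r ^ e * r ^ (1 / 2 : ℝ) :=
  Real.rpow_add_of_nonneg hr he (by norm_num)

/-- Used to lower a surplus power to exactly `1 / 2`, so that all defects have the common sewing
exponents `γᵢ + 1 / 2`. -/
theorem rpow_le_mul_rpow_half (hr : 0 ≤ r) (hrT : r ≤ T) (he : 1 / 2 ≤ e) (he1 : e ≤ 1) :
    r ^ e ≤ (1 + T) * r ^ (1 / 2 : ℝ) := by
  have h := rpow_add_half hr (e := e - 1 / 2) (by linarith)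
  rw [sub_add_cancel] at h
  rw [h]
  gcongr
  exact rpow_le_one_add hr hrT (by linarith) (by linarith)

/-- If `1 ≤ (1 + η) γᵢ`, the smaller of the two mixed bounds `r₁^{ηγ₁} r₂^{γ₂}` and
`r₁^{γ₁} r₂^{ηγ₂}` is dominated by their geometric mean, hence by a multiple of `√r₁ √r₂`. -/
theorem mixed_rpow_le {γ₁ γ₂ η r₁ r₂ M : ℝ} (hη : 0 ≤ η) (hη1 : η ≤ 1) (hγ₁ : γ₁ ≤ 1)
    (hγ₂ : γ₂ ≤ 1) (h₁ : 1 ≤ (1 + η) * γ₁) (h₂ : 1 ≤ (1 + η) * γ₂) (hM : 1 ≤ M)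
    (hr₁ : 0 ≤ r₁) (hr₁T : r₁ ≤ T) (hr₂ : 0 ≤ r₂) (hr₂T : r₂ ≤ T) {u v : ℝ} (hu : 0 ≤ u)
    (hv : 0 ≤ v) (huM : u ≤ M * r₁ ^ γ₁) (hvM : v ≤ M * r₂ ^ γ₂) :
    u ^ η * v ≤ M ^ 2 * (1 + T) * (r₁ ^ (1 / 2 : ℝ) * r₂ ^ (1 / 2 : ℝ)) ∨
      u * v ^ η ≤ M ^ 2 * (1 + T) * (r₁ ^ (1 / 2 : ℝ) * r₂ ^ (1 / 2 : ℝ)) := by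
  -- If both bounds failed, so would the bound on their product, which regroups as `(u ^ η * u) * (v
  -- ^ η * v)`; `key` bounds each factor by a multiple of `rᵢ`.
  by_contra! hcon
  have hT : 0 ≤ T := hr₁.trans hr₁T
  have hγ₁0 : 0 ≤ γ₁ := by nlinarith
  have hγ₂0 : 0 ≤ γ₂ := by nlinarith
  have key : ∀ {r γ w : ℝ}, 0 ≤ r → r ≤ T → 0 ≤ γ → γ ≤ 1 → 1 ≤ (1 + η) * γ → 0 ≤ w →
      w ≤ M * r ^ γ → w ^ η * w ≤ M ^ 2 * (1 + T) * r := by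
    intro r γ w hr hrT hγ hγ1 h hw hwM
    have e1 : w ^ η ≤ M * (r ^ γ) ^ η :=
      calc w ^ η ≤ (M * r ^ γ) ^ η := by gcongr
        _ = M ^ η * (r ^ γ) ^ η := Real.mul_rpow (by linarith) (by positivity)
        _ ≤ M ^ (1 : ℝ) * (r ^ γ) ^ η := by gcongr
        _ = _ := by rw [Real.rpow_one]
    have e2 : r ^ γ * (r ^ γ) ^ η ≤ (1 + T) * r := by
      rw [← Real.rpow_mul hr, ← Real.rpow_add_of_nonneg hr hγ (by positivity),
        show γ + γ * η = ((1 + η) * γ - 1) + 1 by ring,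
        Real.rpow_add_of_nonneg hr (by linarith) zero_le_one, Real.rpow_one]
      gcongr
      exact rpow_le_one_add hr hrT (by linarith) (by nlinarith)
    calc w ^ η * w ≤ (M * (r ^ γ) ^ η) * (M * r ^ γ) := by gcongr
      _ = M ^ 2 * (r ^ γ * (r ^ γ) ^ η) := by ring
      _ ≤ M ^ 2 * ((1 + T) * r) := by gcongr
      _ = _ := by ring
  have k₁ := key hr₁ hr₁T hγ₁0 hγ₁ h₁ hu huM
  have k₂ := key hr₂ hr₂T hγ₂0 hγ₂ h₂ hv hvM
  have s₁ : r₁ ^ (1 / 2 : ℝ) * r₁ ^ (1 / 2 : ℝ) = r₁ := by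
    rw [← Real.rpow_add_of_nonneg hr₁ (by norm_num) (by norm_num)]; norm_num
  have s₂ : r₂ ^ (1 / 2 : ℝ) * r₂ ^ (1 / 2 : ℝ) = r₂ := by
    rw [← Real.rpow_add_of_nonneg hr₂ (by norm_num) (by norm_num)]; norm_num
  have hlt := mul_lt_mul'' hcon.1 hcon.2 (by positivity) (by positivity)
  refine absurd hlt (not_lt.2 ?_)
  calc u ^ η * v * (u * v ^ η) = (u ^ η * u) * (v ^ η * v) := by ring
    _ ≤ (M ^ 2 * (1 + T) * r₁) * (M ^ 2 * (1 + T) * r₂) := by gcongr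
    _ = (M ^ 2 * (1 + T)) ^ 2 * ((r₁ ^ (1 / 2 : ℝ) * r₁ ^ (1 / 2 : ℝ))
          * (r₂ ^ (1 / 2 : ℝ) * r₂ ^ (1 / 2 : ℝ))) := by rw [s₁, s₂]; ring
    _ = _ := by ring

end Rpow

/-! ### Increment bounds, the germ and its defects -/

section Defs

variable {V : Type*} [NormedAddCommGroup V]

/-- Hölder bound for the rectangular increments on `[a, b] × [0, T]`. -/
def RectBound (γ₁ γ₂ T a b K : ℝ) (ψ : ℝ → ℝ → V) : Prop :=
  ∀ ⦃s₁ t₁ s₂ t₂ : ℝ⦄, a ≤ s₁ → s₁ ≤ t₁ → t₁ ≤ b → 0 ≤ s₂ → s₂ ≤ t₂ → t₂ ≤ T →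
    ‖rectIncr ψ s₁ s₂ t₁ t₂‖ ≤ K * ((t₁ - s₁) ^ γ₁ * (t₂ - s₂) ^ γ₂)

/-- Hölder bound in the first variable on `[a, b] × [0, T]`. -/
def FirstBound (γ₁ T a b K : ℝ) (ψ : ℝ → ℝ → V) : Prop :=
  ∀ ⦃s₁ t₁ s₂ : ℝ⦄, a ≤ s₁ → s₁ ≤ t₁ → t₁ ≤ b → 0 ≤ s₂ → s₂ ≤ T →
    ‖ψ t₁ s₂ - ψ s₁ s₂‖ ≤ K * (t₁ - s₁) ^ γ₁

/-- Hölder bound in the second variable on `[a, b] × [0, T]`. -/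
def SecondBound (γ₂ T a b K : ℝ) (ψ : ℝ → ℝ → V) : Prop :=
  ∀ ⦃s₁ s₂ t₂ : ℝ⦄, a ≤ s₁ → s₁ ≤ b → 0 ≤ s₂ → s₂ ≤ t₂ → t₂ ≤ T →
    ‖ψ s₁ t₂ - ψ s₁ s₂‖ ≤ K * (t₂ - s₂) ^ γ₂

/-- Hölder bound for the rectangular increments of a driver on `[0, T]²`. -/
def DriverBound (η γ₁ γ₂ T M : ℝ) (A : ℝ → ℝ → V → V) : Prop :=
  ∀ ⦃s₁ t₁ s₂ t₂ : ℝ⦄, 0 ≤ s₁ → s₁ ≤ t₁ → t₁ ≤ T → 0 ≤ s₂ → s₂ ≤ t₂ → t₂ ≤ T →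
    DiffBound η (M * ((t₁ - s₁) ^ γ₁ * (t₂ - s₂) ^ γ₂)) (rectIncr A s₁ s₂ t₁ t₂)

/-- The dyadic sums of the germ `□_{s,t} A (θ_s)` converge to the increments of `θ`. -/
def IsDyadicSolution (T : ℝ) (A : ℝ → ℝ → V → V) (θ : ℝ → ℝ → V) : Prop :=
  ∀ ⦃s₁ t₁ s₂ t₂ : ℝ⦄, 0 ≤ s₁ → ∀ h₁ : s₁ ≤ t₁, t₁ ≤ T → 0 ≤ s₂ → ∀ h₂ : s₂ ≤ t₂, t₂ ≤ T →
    Filter.Tendsto (fun n => (IntervalPartition.dyadic n h₁).sum fun u₁ v₁ =>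
      (IntervalPartition.dyadic n h₂).sum fun u₂ v₂ => rectIncr A u₁ u₂ v₁ v₂ (θ u₁ u₂))
      Filter.atTop (nhds (rectIncr θ s₁ s₂ t₁ t₂))

/-- The difference of the germs of two nonlinear Young integrals. -/
def germSub (A A' : ℝ → ℝ → V → V) (θ θ' : ℝ → ℝ → V) (s₁ t₁ s₂ t₂ : ℝ) : V :=
  rectIncr A s₁ s₂ t₁ t₂ (θ s₁ s₂) - rectIncr A' s₁ s₂ t₁ t₂ (θ' s₁ s₂)

/-- Evaluating `A - A'` at `θ` and putting the perturbation `θ' - θ` inside `A'` asks for third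
differences of `A'` only. -/
theorem germSub_eq (A A' : ℝ → ℝ → V → V) (θ θ' : ℝ → ℝ → V) (s₁ t₁ s₂ t₂ : ℝ) :
    germSub A A' θ θ' s₁ t₁ s₂ t₂ = rectIncr (A - A') s₁ s₂ t₁ t₂ (θ s₁ s₂)
      - (rectIncr A' s₁ s₂ t₁ t₂ (θ' s₁ s₂) - rectIncr A' s₁ s₂ t₁ t₂ (θ s₁ s₂)) := by
  simp only [germSub, rectIncr, Pi.sub_apply, Pi.add_apply]
  abel

theorem germSub_defect_first (A A' : ℝ → ℝ → V → V) (θ θ' : ℝ → ℝ → V) (s₁ u₁ t₁ s₂ t₂ : ℝ) :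
    germSub A A' θ θ' s₁ t₁ s₂ t₂ - germSub A A' θ θ' s₁ u₁ s₂ t₂ - germSub A A' θ θ' u₁ t₁ s₂ t₂ =
      ((rectIncr A' u₁ s₂ t₁ t₂ (θ' u₁ s₂) - rectIncr A' u₁ s₂ t₁ t₂ (θ u₁ s₂))
        - (rectIncr A' u₁ s₂ t₁ t₂ (θ' s₁ s₂) - rectIncr A' u₁ s₂ t₁ t₂ (θ s₁ s₂)))
      - (rectIncr (A - A') u₁ s₂ t₁ t₂ (θ u₁ s₂) - rectIncr (A - A') u₁ s₂ t₁ t₂ (θ s₁ s₂)) := by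
  simp only [germSub, rectIncr, Pi.sub_apply, Pi.add_apply]
  abel

theorem germSub_defect_second (A A' : ℝ → ℝ → V → V) (θ θ' : ℝ → ℝ → V) (s₁ t₁ s₂ u₂ t₂ : ℝ) :
    germSub A A' θ θ' s₁ t₁ s₂ t₂ - germSub A A' θ θ' s₁ t₁ s₂ u₂ - germSub A A' θ θ' s₁ t₁ u₂ t₂ =
      ((rectIncr A' s₁ u₂ t₁ t₂ (θ' s₁ u₂) - rectIncr A' s₁ u₂ t₁ t₂ (θ s₁ u₂))
        - (rectIncr A' s₁ u₂ t₁ t₂ (θ' s₁ s₂) - rectIncr A' s₁ u₂ t₁ t₂ (θ s₁ s₂)))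
      - (rectIncr (A - A') s₁ u₂ t₁ t₂ (θ s₁ u₂) - rectIncr (A - A') s₁ u₂ t₁ t₂ (θ s₁ s₂)) := by
  simp only [germSub, rectIncr, Pi.sub_apply, Pi.add_apply]
  abel

/-- As in the one-variable defects, additivity of rectangular increments moves everything onto the
far cell `[u₁, t₁] × [u₂, t₂]`; what remains is the variation of the evaluation point over `[s₁, u₁]
× [s₂, u₂]`. -/
theorem germSub_defect_mixed (A A' : ℝ → ℝ → V → V) (θ θ' : ℝ → ℝ → V)
    (s₁ u₁ t₁ s₂ u₂ t₂ : ℝ) :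
    (germSub A A' θ θ' s₁ t₁ s₂ t₂ - germSub A A' θ θ' s₁ u₁ s₂ t₂
        - germSub A A' θ θ' u₁ t₁ s₂ t₂)
      - (germSub A A' θ θ' s₁ t₁ s₂ u₂ - germSub A A' θ θ' s₁ u₁ s₂ u₂
        - germSub A A' θ θ' u₁ t₁ s₂ u₂)
      - (germSub A A' θ θ' s₁ t₁ u₂ t₂ - germSub A A' θ θ' s₁ u₁ u₂ t₂
        - germSub A A' θ θ' u₁ t₁ u₂ t₂) =
      (rectIncr (A - A') u₁ u₂ t₁ t₂ (θ u₁ u₂) - rectIncr (A - A') u₁ u₂ t₁ t₂ (θ u₁ s₂)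
        - rectIncr (A - A') u₁ u₂ t₁ t₂ (θ s₁ u₂) + rectIncr (A - A') u₁ u₂ t₁ t₂ (θ s₁ s₂))
      - ((rectIncr A' u₁ u₂ t₁ t₂ (θ' u₁ u₂) - rectIncr A' u₁ u₂ t₁ t₂ (θ u₁ u₂))
        - (rectIncr A' u₁ u₂ t₁ t₂ (θ' u₁ s₂) - rectIncr A' u₁ u₂ t₁ t₂ (θ u₁ s₂))
        - (rectIncr A' u₁ u₂ t₁ t₂ (θ' s₁ u₂) - rectIncr A' u₁ u₂ t₁ t₂ (θ s₁ u₂))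
        + (rectIncr A' u₁ u₂ t₁ t₂ (θ' s₁ s₂) - rectIncr A' u₁ u₂ t₁ t₂ (θ s₁ s₂))) := by
  simp only [germSub, rectIncr, Pi.sub_apply, Pi.add_apply]
  abel

/-- The conditions on the exponents. -/
structure Exponents (η γ₁ γ₂ : ℝ) : Prop where
  eta_nonneg : 0 ≤ η
  eta_le : η ≤ 1
  half_lt₁ : 1 / 2 < γ₁
  le_one₁ : γ₁ ≤ 1
  half_lt₂ : 1 / 2 < γ₂
  le_one₂ : γ₂ ≤ 1
  one_le₁ : 1 ≤ (1 + η) * γ₁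
  one_le₂ : 1 ≤ (1 + η) * γ₂

/-- Two dyadic solutions `θ`, `θ'` on the strip `[a, b] × [0, T]` with quantitative bounds on
the data, on `θ`, and on the difference `θ' - θ`. -/
structure StripData (η γ₁ γ₂ T a b M M' D X Y : ℝ) (A A' : ℝ → ℝ → V → V) (θ θ' : ℝ → ℝ → V) :
    Prop where
  zero_le_left : 0 ≤ a
  left_le : a ≤ b
  le_T : b ≤ T
  one_le_M : 1 ≤ M
  M'_nonneg : 0 ≤ M'
  D_nonneg : 0 ≤ D
  X_nonneg : 0 ≤ X
  Y_nonneg : 0 ≤ Y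
  driver : DriverBound η γ₁ γ₂ T M A'
  driver_sub : DriverBound η γ₁ γ₂ T D (A - A')
  first : FirstBound γ₁ T a b M θ
  second : SecondBound γ₂ T a b M θ
  rect : RectBound γ₁ γ₂ T a b M θ
  crude : SecondBound γ₂ T a b M' (θ' - θ)
  corner : ‖(θ' - θ) a 0‖ ≤ X
  -- The interval `[a, a]` here, and the height `0` in `bottom_edge`, restrict the bounds to a
  -- single edge.
  left_edge : SecondBound γ₂ T a a X (θ' - θ)
  bottom_edge : FirstBound γ₁ 0 a b D (θ' - θ)
  diff_rect : RectBound γ₁ γ₂ T a b Y (θ' - θ)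

namespace StripData

variable {η γ₁ γ₂ T a b M M' D X Y : ℝ} {A A' : ℝ → ℝ → V → V} {θ θ' : ℝ → ℝ → V}

theorem T_nonneg (h : StripData η γ₁ γ₂ T a b M M' D X Y A A' θ θ') : 0 ≤ T :=
  h.zero_le_left.trans (h.left_le.trans h.le_T)

theorem rpow_le_left (h : StripData η γ₁ γ₂ T a b M M' D X Y A A' θ θ') {s t γ : ℝ} (hs : a ≤ s)
    (hst : s ≤ t) (ht : t ≤ b) (hγ : 1 / 2 < γ) (hγ1 : γ ≤ 1) :
    (t - s) ^ γ ≤ (1 + T) * (b - a) ^ (1 / 2 : ℝ) := by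
  have hT := h.T_nonneg
  have h1 := h.zero_le_left
  have h2 := h.le_T
  calc (t - s) ^ γ ≤ (b - a) ^ γ := by
        apply Real.rpow_le_rpow (by linarith) (by linarith) (by linarith)
    _ ≤ _ := rpow_le_mul_rpow_half (by linarith) (by linarith) hγ.le hγ1

/-- Transport from the left edge crosses a rectangle of width at most `b - a`, which puts the small
factor in front of `Y`. -/
theorem second_diff (hE : Exponents η γ₁ γ₂) (h : StripData η γ₁ γ₂ T a b M M' D X Y A A' θ θ') :
    SecondBound γ₂ T a b ((1 + T) * (X + D + (b - a) ^ (1 / 2 : ℝ) * Y)) (θ' - θ) := by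
  intro s₁ s₂ t₂ has hsb hs₂ hst₂ ht₂
  have hT := h.T_nonneg
  have h1 := h.left_edge le_rfl le_rfl hs₂ hst₂ ht₂
  have h2 := h.diff_rect le_rfl has hsb hs₂ hst₂ ht₂
  have hx : 0 ≤ (t₂ - s₂) ^ γ₂ := Real.rpow_nonneg (by linarith) _
  have h3 := h.rpow_le_left le_rfl has hsb hE.half_lt₁ hE.le_one₁
  have hX := h.X_nonneg
  have hD := h.D_nonneg
  have hY := h.Y_nonneg
  calc _ = ‖((θ' - θ) a t₂ - (θ' - θ) a s₂) + rectIncr (θ' - θ) a s₂ s₁ t₂‖ :=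
        congrArg norm (by simp only [rectIncr]; abel)
    _ ≤ X * (t₂ - s₂) ^ γ₂ + Y * ((s₁ - a) ^ γ₁ * (t₂ - s₂) ^ γ₂) := norm_add_le_of_le h1 h2
    _ ≤ X * (t₂ - s₂) ^ γ₂ + Y * (((1 + T) * (b - a) ^ (1 / 2 : ℝ)) * (t₂ - s₂) ^ γ₂) := by gcongr
    _ = (X + (1 + T) * ((b - a) ^ (1 / 2 : ℝ) * Y)) * (t₂ - s₂) ^ γ₂ := by ring
    _ ≤ _ := by
      gcongr
      nlinarith [mul_nonneg hT hX, mul_nonneg hT hD]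

/-- Transport from the bottom edge crosses the full height, so `Y` comes without a small factor.
This bound enters only defects in the first variable, where sewing supplies one. -/
theorem first_diff (hE : Exponents η γ₁ γ₂) (h : StripData η γ₁ γ₂ T a b M M' D X Y A A' θ θ') :
    FirstBound γ₁ T a b ((1 + T) * (X + D + Y)) (θ' - θ) := by
  intro s₁ t₁ s₂ has hst hsb hs₂ hs₂T
  have hT := h.T_nonneg
  have h1 := h.bottom_edge has hst hsb le_rfl le_rfl
  have h2 := h.diff_rect has hst hsb le_rfl hs₂ hs₂T
  have hx : 0 ≤ (t₁ - s₁) ^ γ₁ := Real.rpow_nonneg (by linarith) _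
  have h3 : (s₂ - 0) ^ γ₂ ≤ 1 + T := rpow_le_one_add (by linarith) (by linarith)
    (by linarith [hE.half_lt₂]) hE.le_one₂
  have hX := h.X_nonneg
  have hD := h.D_nonneg
  have hY := h.Y_nonneg
  calc _ = ‖((θ' - θ) t₁ 0 - (θ' - θ) s₁ 0) + rectIncr (θ' - θ) s₁ 0 t₁ s₂‖ :=
        congrArg norm (by simp only [rectIncr]; abel)
    _ ≤ D * (t₁ - s₁) ^ γ₁ + Y * ((t₁ - s₁) ^ γ₁ * (s₂ - 0) ^ γ₂) := norm_add_le_of_le h1 h2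
    _ ≤ D * (t₁ - s₁) ^ γ₁ + Y * ((t₁ - s₁) ^ γ₁ * (1 + T)) := by gcongr
    _ = (D + (1 + T) * Y) * (t₁ - s₁) ^ γ₁ := by ring
    _ ≤ _ := by
      gcongr
      nlinarith [mul_nonneg hT hX, mul_nonneg hT hD]

/-- Along the bottom edge from the corner, then vertically by `second_diff`; the weight of `Y` stays
small. -/
theorem sup_diff (hE : Exponents η γ₁ γ₂) (h : StripData η γ₁ γ₂ T a b M M' D X Y A A' θ θ')
    {s₁ s₂ : ℝ} (has : a ≤ s₁) (hsb : s₁ ≤ b) (hs₂ : 0 ≤ s₂) (hs₂T : s₂ ≤ T) :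
    ‖(θ' - θ) s₁ s₂‖ ≤ 2 * (1 + T) ^ 2 * (X + D + (b - a) ^ (1 / 2 : ℝ) * Y) := by
  have hT := h.T_nonneg
  have h0 := h.corner
  have h1 := h.bottom_edge le_rfl has hsb le_rfl le_rfl
  have h2 := h.second_diff hE has hsb le_rfl hs₂ hs₂T
  have h3 : (s₂ - 0) ^ γ₂ ≤ 1 + T := rpow_le_one_add (by linarith) (by linarith)
    (by linarith [hE.half_lt₂]) hE.le_one₂
  have h4 : (s₁ - a) ^ γ₁ ≤ 1 + T := rpow_le_one_add (by linarith)
    (by linarith [h.le_T, h.zero_le_left]) (by linarith [hE.half_lt₁]) hE.le_one₁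
  have hX := h.X_nonneg
  have hD := h.D_nonneg
  have hY := h.Y_nonneg
  have hs : 0 ≤ (b - a) ^ (1 / 2 : ℝ) := Real.rpow_nonneg (by linarith [h.left_le]) _
  set W := X + D + (b - a) ^ (1 / 2 : ℝ) * Y with hW
  have hXW : X + D ≤ W := by nlinarith [mul_nonneg hs hY]
  have hW0 : 0 ≤ W := by linarith
  calc _ = ‖(θ' - θ) a 0 + ((θ' - θ) s₁ 0 - (θ' - θ) a 0) + ((θ' - θ) s₁ s₂ - (θ' - θ) s₁ 0)‖ :=
        congrArg norm (by abel)
    _ ≤ X + D * (s₁ - a) ^ γ₁ + (1 + T) * W * (s₂ - 0) ^ γ₂ :=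
        norm_add_le_of_le (norm_add_le_of_le h0 h1) h2
    _ ≤ X + D * (1 + T) + (1 + T) * W * (1 + T) := by gcongr
    _ ≤ (1 + T) * (X + D) + (1 + T) ^ 2 * W := by nlinarith [mul_nonneg hT hX]
    _ ≤ (1 + T) * W + (1 + T) ^ 2 * W := by gcongr
    _ ≤ _ := by nlinarith [mul_nonneg hT hW0, mul_nonneg (mul_nonneg hT hT) hW0]

end StripData

end Defs

/-! ### Size and defects of the germ on a strip -/

section

variable {V : Type*} [NormedAddCommGroup V]

namespace StripData

variable {η γ₁ γ₂ T a b M M' D X Y : ℝ} {A A' : ℝ → ℝ → V → V} {θ θ' : ℝ → ℝ → V}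

theorem rpow_half_le (h : StripData η γ₁ γ₂ T a b M M' D X Y A A' θ θ') :
    (b - a) ^ (1 / 2 : ℝ) ≤ 1 + T :=
  rpow_le_one_add (by linarith [h.left_le]) (by linarith [h.le_T, h.zero_le_left]) (by norm_num)
    (by norm_num)

theorem weighted_nonneg (h : StripData η γ₁ γ₂ T a b M M' D X Y A A' θ θ') :
    0 ≤ X + D + (b - a) ^ (1 / 2 : ℝ) * Y := by
  have hs : 0 ≤ (b - a) ^ (1 / 2 : ℝ) := Real.rpow_nonneg (by linarith [h.left_le]) _
  have := mul_nonneg hs h.Y_nonneg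
  linarith [h.X_nonneg, h.D_nonneg]

theorem weighted_le (h : StripData η γ₁ γ₂ T a b M M' D X Y A A' θ θ') :
    X + D + (b - a) ^ (1 / 2 : ℝ) * Y ≤ (1 + T) * (X + D + Y) := by
  have h1 := mul_le_mul_of_nonneg_right h.rpow_half_le h.Y_nonneg
  nlinarith [mul_nonneg h.T_nonneg h.X_nonneg, mul_nonneg h.T_nonneg h.D_nonneg]

theorem norm_germSub_le (hE : Exponents η γ₁ γ₂)
    (h : StripData η γ₁ γ₂ T a b M M' D X Y A A' θ θ') {s₁ t₁ s₂ t₂ : ℝ} (hs₁ : a ≤ s₁)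
    (hst₁ : s₁ ≤ t₁) (ht₁ : t₁ ≤ b) (hs₂ : 0 ≤ s₂) (hst₂ : s₂ ≤ t₂) (ht₂ : t₂ ≤ T) :
    ‖germSub A A' θ θ' s₁ t₁ s₂ t₂‖ ≤ (1 + 2 * (1 + T) ^ 2 * M)
      * (X + D + (b - a) ^ (1 / 2 : ℝ) * Y) * ((t₁ - s₁) ^ γ₁ * (t₂ - s₂) ^ γ₂) := by
  have hf := h.driver (h.zero_le_left.trans hs₁) hst₁ (ht₁.trans h.le_T) hs₂ hst₂ ht₂
  have hB := h.driver_sub (h.zero_le_left.trans hs₁) hst₁ (ht₁.trans h.le_T) hs₂ hst₂ ht₂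
  have hψ := h.sup_diff hE hs₁ (hst₁.trans ht₁) hs₂ (hst₂.trans ht₂)
  have hx : 0 ≤ (t₁ - s₁) ^ γ₁ * (t₂ - s₂) ^ γ₂ :=
    mul_nonneg (Real.rpow_nonneg (by linarith) _) (Real.rpow_nonneg (by linarith) _)
  have hDW : D ≤ X + D + (b - a) ^ (1 / 2 : ℝ) * Y := by
    have := mul_nonneg (Real.rpow_nonneg (sub_nonneg.2 h.left_le) (1 / 2 : ℝ)) h.Y_nonneg
    linarith [h.X_nonneg]
  have hM := h.one_le_M
  set W := X + D + (b - a) ^ (1 / 2 : ℝ) * Y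
  set x := (t₁ - s₁) ^ γ₁ * (t₂ - s₂) ^ γ₂
  rw [germSub_eq]
  calc _ ≤ D * x + M * x * (2 * (1 + T) ^ 2 * W) := by
        refine norm_sub_le_of_le (hB.zero _) ((hf.norm_sub_le' _ _).trans ?_)
        gcongr
        exact hψ
    _ ≤ W * x + M * x * (2 * (1 + T) ^ 2 * W) := by gcongr
    _ = _ := by ring

/-- Only the sup norm of `θ' - θ` and its variation in the second variable occur, so the weighted
quantity suffices. This matters because sewing in the second variable yields no power of `b - a`. -/
theorem norm_defect_second_le (hE : Exponents η γ₁ γ₂)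
    (h : StripData η γ₁ γ₂ T a b M M' D X Y A A' θ θ') {s₁ t₁ s₂ u₂ t₂ : ℝ} (hs₁ : a ≤ s₁)
    (hst₁ : s₁ ≤ t₁) (ht₁ : t₁ ≤ b) (hs₂ : 0 ≤ s₂) (hsu₂ : s₂ ≤ u₂) (hut₂ : u₂ ≤ t₂)
    (ht₂ : t₂ ≤ T) :
    ‖germSub A A' θ θ' s₁ t₁ s₂ t₂ - germSub A A' θ θ' s₁ t₁ s₂ u₂
        - germSub A A' θ θ' s₁ t₁ u₂ t₂‖ ≤
      (1 + T) * (M + M * ((1 + T) + 2 * (1 + T) ^ 2 * M))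
        * (X + D + (b - a) ^ (1 / 2 : ℝ) * Y) * (t₁ - s₁) ^ γ₁ * (t₂ - s₂) ^ (γ₂ + 1 / 2) := by
  have hu₂ := hs₂.trans hsu₂
  have hf := h.driver (h.zero_le_left.trans hs₁) hst₁ (ht₁.trans h.le_T) hu₂ hut₂ ht₂
  have hB := h.driver_sub (h.zero_le_left.trans hs₁) hst₁ (ht₁.trans h.le_T) hu₂ hut₂ ht₂
  have hψ := h.sup_diff hE hs₁ (hst₁.trans ht₁) hs₂ (hsu₂.trans (hut₂.trans ht₂))
  have hψ₂ := h.second_diff hE hs₁ (hst₁.trans ht₁) hs₂ hsu₂ (hut₂.trans ht₂)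
  have hθ₂ := h.second hs₁ (hst₁.trans ht₁) hs₂ hsu₂ (hut₂.trans ht₂)
  have hγ₂ : 0 ≤ γ₂ := by linarith [hE.half_lt₂]
  have hx₁ : 0 ≤ (t₁ - s₁) ^ γ₁ := Real.rpow_nonneg (by linarith) _
  have hx₂ : 0 ≤ (t₂ - s₂) ^ γ₂ := Real.rpow_nonneg (by linarith) _
  have hle₁ : (t₂ - u₂) ^ γ₂ ≤ (t₂ - s₂) ^ γ₂ :=
    Real.rpow_le_rpow (by linarith) (by linarith) hγ₂
  have hle₂ : (u₂ - s₂) ^ γ₂ ≤ (t₂ - s₂) ^ γ₂ :=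
    Real.rpow_le_rpow (by linarith) (by linarith) hγ₂
  have hxy : (t₂ - s₂) ^ γ₂ ≤ (1 + T) * (t₂ - s₂) ^ (1 / 2 : ℝ) :=
    rpow_le_mul_rpow_half (by linarith) (by linarith) hE.half_lt₂.le hE.le_one₂
  have hDW : D ≤ X + D + (b - a) ^ (1 / 2 : ℝ) * Y := by
    have := mul_nonneg (Real.rpow_nonneg (sub_nonneg.2 h.left_le) (1 / 2 : ℝ)) h.Y_nonneg
    linarith [h.X_nonneg]
  have hM : 0 ≤ M := by linarith [h.one_le_M]
  have hW := h.weighted_nonneg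
  have hT := h.T_nonneg
  have hD := h.D_nonneg
  rw [rpow_add_half (by linarith) hγ₂]
  set W := X + D + (b - a) ^ (1 / 2 : ℝ) * Y
  set x₁ := (t₁ - s₁) ^ γ₁
  set x₂ := (t₂ - s₂) ^ γ₂
  set y₂ := (t₂ - s₂) ^ (1 / 2 : ℝ)
  have hf' : DiffBound η (M * (x₁ * x₂)) (rectIncr A' s₁ u₂ t₁ t₂) := hf.mono (by gcongr)
  have hB' : DiffBound η (D * (x₁ * x₂)) (rectIncr (A - A') s₁ u₂ t₁ t₂) := hB.mono (by gcongr)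
  rw [germSub_defect_second]
  calc _ ≤ M * (x₁ * x₂) * ((1 + T) * W * x₂ + M * x₂ * (2 * (1 + T) ^ 2 * W))
        + D * (x₁ * x₂) * (M * x₂) := by
        refine norm_sub_le_of_le ((hf'.norm_two_point_le _ _ _ _).trans ?_)
          ((hB'.norm_sub_le' _ _).trans ?_)
        · gcongr
          · exact hψ₂.trans (by gcongr)
          · exact hθ₂.trans (by gcongr)
          · exact hψ
        · gcongr
          exact hθ₂.trans (by gcongr)
    _ ≤ M * (x₁ * x₂) * ((1 + T) * W * x₂ + M * x₂ * (2 * (1 + T) ^ 2 * W))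
        + W * (x₁ * x₂) * (M * x₂) := by gcongr
    _ = (M + M * ((1 + T) + 2 * (1 + T) ^ 2 * M)) * W * x₁ * x₂ * x₂ := by ring
    _ ≤ (M + M * ((1 + T) + 2 * (1 + T) ^ 2 * M)) * W * x₁ * x₂ * ((1 + T) * y₂) := by gcongr
    _ = _ := by ring

/-- Here `Y` appears with full weight; the compensation is the extra `(t₁ - s₁) ^ (1 / 2)`. -/
theorem norm_defect_first_le (hE : Exponents η γ₁ γ₂)
    (h : StripData η γ₁ γ₂ T a b M M' D X Y A A' θ θ') {s₁ u₁ t₁ s₂ t₂ : ℝ} (hs₁ : a ≤ s₁)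
    (hsu₁ : s₁ ≤ u₁) (hut₁ : u₁ ≤ t₁) (ht₁ : t₁ ≤ b) (hs₂ : 0 ≤ s₂) (hst₂ : s₂ ≤ t₂)
    (ht₂ : t₂ ≤ T) :
    ‖germSub A A' θ θ' s₁ t₁ s₂ t₂ - germSub A A' θ θ' s₁ u₁ s₂ t₂
        - germSub A A' θ θ' u₁ t₁ s₂ t₂‖ ≤
      (1 + T) * (M + M * ((1 + T) + 2 * (1 + T) ^ 3 * M))
        * (X + D + Y) * (t₂ - s₂) ^ γ₂ * (t₁ - s₁) ^ (γ₁ + 1 / 2) := by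
  have hu₁ := hs₁.trans hsu₁
  have hf := h.driver (h.zero_le_left.trans hu₁) hut₁ (ht₁.trans h.le_T) hs₂ hst₂ ht₂
  have hB := h.driver_sub (h.zero_le_left.trans hu₁) hut₁ (ht₁.trans h.le_T) hs₂ hst₂ ht₂
  have hψ := h.sup_diff hE hs₁ (hsu₁.trans (hut₁.trans ht₁)) hs₂ (hst₂.trans ht₂)
  have hψ₁ := h.first_diff hE hs₁ hsu₁ (hut₁.trans ht₁) hs₂ (hst₂.trans ht₂)
  have hθ₁ := h.first hs₁ hsu₁ (hut₁.trans ht₁) hs₂ (hst₂.trans ht₂)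
  have hγ₁ : 0 ≤ γ₁ := by linarith [hE.half_lt₁]
  have hx₁ : 0 ≤ (t₁ - s₁) ^ γ₁ := Real.rpow_nonneg (by linarith) _
  have hx₂ : 0 ≤ (t₂ - s₂) ^ γ₂ := Real.rpow_nonneg (by linarith) _
  have hle₁ : (t₁ - u₁) ^ γ₁ ≤ (t₁ - s₁) ^ γ₁ :=
    Real.rpow_le_rpow (by linarith) (by linarith) hγ₁
  have hle₂ : (u₁ - s₁) ^ γ₁ ≤ (t₁ - s₁) ^ γ₁ :=
    Real.rpow_le_rpow (by linarith) (by linarith) hγ₁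
  have hxy : (t₁ - s₁) ^ γ₁ ≤ (1 + T) * (t₁ - s₁) ^ (1 / 2 : ℝ) :=
    rpow_le_mul_rpow_half (by linarith) (by linarith [h.le_T, h.zero_le_left])
      hE.half_lt₁.le hE.le_one₁
  have hM : 0 ≤ M := by linarith [h.one_le_M]
  have hWV := h.weighted_le
  have hT := h.T_nonneg
  have hD := h.D_nonneg
  have hX := h.X_nonneg
  have hY := h.Y_nonneg
  have hψ' : ‖(θ' - θ) s₁ s₂‖ ≤ 2 * (1 + T) ^ 3 * (X + D + Y) :=
    calc _ ≤ _ := hψ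
      _ ≤ 2 * (1 + T) ^ 2 * ((1 + T) * (X + D + Y)) := by gcongr
      _ = _ := by ring
  have hDV : D ≤ X + D + Y := by linarith
  have hV : 0 ≤ X + D + Y := by linarith
  rw [rpow_add_half (by linarith) hγ₁]
  set W := X + D + Y
  set x₁ := (t₁ - s₁) ^ γ₁
  set x₂ := (t₂ - s₂) ^ γ₂
  set y₁ := (t₁ - s₁) ^ (1 / 2 : ℝ)
  have hf' : DiffBound η (M * (x₁ * x₂)) (rectIncr A' u₁ s₂ t₁ t₂) := hf.mono (by gcongr)
  have hB' : DiffBound η (D * (x₁ * x₂)) (rectIncr (A - A') u₁ s₂ t₁ t₂) := hB.mono (by gcongr)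
  rw [germSub_defect_first]
  calc _ ≤ M * (x₁ * x₂) * ((1 + T) * W * x₁ + M * x₁ * (2 * (1 + T) ^ 3 * W))
        + D * (x₁ * x₂) * (M * x₁) := by
        refine norm_sub_le_of_le ((hf'.norm_two_point_le _ _ _ _).trans ?_)
          ((hB'.norm_sub_le' _ _).trans ?_)
        · gcongr
          · exact hψ₁.trans (by gcongr)
          · exact hθ₁.trans (by gcongr)
          · exact hψ'
        · gcongr
          exact hθ₁.trans (by gcongr)
    _ ≤ M * (x₁ * x₂) * ((1 + T) * W * x₁ + M * x₁ * (2 * (1 + T) ^ 3 * W))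
        + W * (x₁ * x₂) * (M * x₁) := by gcongr
    _ = (M + M * ((1 + T) + 2 * (1 + T) ^ 3 * M)) * W * x₂ * x₁ * x₁ := by ring
    _ ≤ (M + M * ((1 + T) + 2 * (1 + T) ^ 3 * M)) * W * x₂ * x₁ * ((1 + T) * y₁) := by gcongr
    _ = _ := by ring

/-- The constant in the mixed defect of the germ. -/
def mixedConst (T M M' : ℝ) : ℝ :=
  (M + M ^ 2) * (1 + T) ^ 2 + M * ((1 + T) ^ 2 * (1 + 2 * (1 + T) ^ 3 * M + (1 + T) * M'
    + (1 + T) * M + (1 + T) ^ 2 * M) + 2 * (1 + T) ^ 4 * M ^ 2)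

/-- The rectangular composition estimates for `A - A'` and `A'`. The product of the increments of
`θ' - θ` in the two variables is quadratic; bounding the second factor by `M'` keeps the estimate
linear in `X + D + Y`. -/
theorem norm_defect_mixed_le (hE : Exponents η γ₁ γ₂)
    (h : StripData η γ₁ γ₂ T a b M M' D X Y A A' θ θ') {s₁ u₁ t₁ s₂ u₂ t₂ : ℝ} (hs₁ : a ≤ s₁)
    (hsu₁ : s₁ ≤ u₁) (hut₁ : u₁ ≤ t₁) (ht₁ : t₁ ≤ b) (hs₂ : 0 ≤ s₂) (hsu₂ : s₂ ≤ u₂)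
    (hut₂ : u₂ ≤ t₂) (ht₂ : t₂ ≤ T) :
    ‖(germSub A A' θ θ' s₁ t₁ s₂ t₂ - germSub A A' θ θ' s₁ u₁ s₂ t₂
        - germSub A A' θ θ' u₁ t₁ s₂ t₂)
      - (germSub A A' θ θ' s₁ t₁ s₂ u₂ - germSub A A' θ θ' s₁ u₁ s₂ u₂
        - germSub A A' θ θ' u₁ t₁ s₂ u₂)
      - (germSub A A' θ θ' s₁ t₁ u₂ t₂ - germSub A A' θ θ' s₁ u₁ u₂ t₂
        - germSub A A' θ θ' u₁ t₁ u₂ t₂)‖ ≤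
      mixedConst T M M' * (X + D + Y) * (t₁ - s₁) ^ (γ₁ + 1 / 2) * (t₂ - s₂) ^ (γ₂ + 1 / 2) := by
  have hu₁ := hs₁.trans hsu₁
  have hu₂ := hs₂.trans hsu₂
  have hu₁b := hut₁.trans ht₁
  have hu₂T := hut₂.trans ht₂
  have hs₁b := hsu₁.trans hu₁b
  have hs₂T := hsu₂.trans hu₂T
  have hf := h.driver (h.zero_le_left.trans hu₁) hut₁ (ht₁.trans h.le_T) hu₂ hut₂ ht₂
  have hB := h.driver_sub (h.zero_le_left.trans hu₁) hut₁ (ht₁.trans h.le_T) hu₂ hut₂ ht₂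
  have hψ₁ := h.first_diff hE hs₁ hsu₁ hu₁b hs₂ hs₂T
  have hψ₂ := h.second_diff hE hs₁ hs₁b hs₂ hsu₂ hu₂T
  have hψ₂' := h.crude hs₁ hs₁b hs₂ hsu₂ hu₂T
  have hψ₁₂ := h.diff_rect hs₁ hsu₁ hu₁b hs₂ hsu₂ hu₂T
  have hθ₁ := h.first hs₁ hsu₁ hu₁b hs₂ hs₂T
  have hθ₂ := h.second hs₁ hs₁b hs₂ hsu₂ hu₂T
  have hθ₁₂ := h.rect hs₁ hsu₁ hu₁b hs₂ hsu₂ hu₂T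
  have hγ₁ : 0 ≤ γ₁ := by linarith [hE.half_lt₁]
  have hγ₂ : 0 ≤ γ₂ := by linarith [hE.half_lt₂]
  have hr₁ : 0 ≤ t₁ - s₁ := by linarith
  have hr₂ : 0 ≤ t₂ - s₂ := by linarith
  have hr₁T : t₁ - s₁ ≤ T := by linarith [h.le_T, h.zero_le_left]
  have hr₂T : t₂ - s₂ ≤ T := by linarith
  have hx₁ : 0 ≤ (t₁ - s₁) ^ γ₁ := Real.rpow_nonneg hr₁ _
  have hx₂ : 0 ≤ (t₂ - s₂) ^ γ₂ := Real.rpow_nonneg hr₂ _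
  have hy₁ : 0 ≤ (t₁ - s₁) ^ (1 / 2 : ℝ) := Real.rpow_nonneg hr₁ _
  have hy₂ : 0 ≤ (t₂ - s₂) ^ (1 / 2 : ℝ) := Real.rpow_nonneg hr₂ _
  have hle₁ : (t₁ - u₁) ^ γ₁ ≤ (t₁ - s₁) ^ γ₁ :=
    Real.rpow_le_rpow (by linarith) (by linarith) hγ₁
  have hle₁' : (u₁ - s₁) ^ γ₁ ≤ (t₁ - s₁) ^ γ₁ :=
    Real.rpow_le_rpow (by linarith) (by linarith) hγ₁
  have hle₂ : (t₂ - u₂) ^ γ₂ ≤ (t₂ - s₂) ^ γ₂ :=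
    Real.rpow_le_rpow (by linarith) (by linarith) hγ₂
  have hle₂' : (u₂ - s₂) ^ γ₂ ≤ (t₂ - s₂) ^ γ₂ :=
    Real.rpow_le_rpow (by linarith) (by linarith) hγ₂
  have hxy₁ : (t₁ - s₁) ^ γ₁ ≤ (1 + T) * (t₁ - s₁) ^ (1 / 2 : ℝ) :=
    rpow_le_mul_rpow_half hr₁ hr₁T hE.half_lt₁.le hE.le_one₁
  have hxy₂ : (t₂ - s₂) ^ γ₂ ≤ (1 + T) * (t₂ - s₂) ^ (1 / 2 : ℝ) :=
    rpow_le_mul_rpow_half hr₂ hr₂T hE.half_lt₂.le hE.le_one₂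
  have hM : 0 ≤ M := by linarith [h.one_le_M]
  have hM' := h.M'_nonneg
  have hWV := h.weighted_le
  have hT := h.T_nonneg
  have hD := h.D_nonneg
  have hX := h.X_nonneg
  have hY := h.Y_nonneg
  have hsup : ∀ {v₁ v₂ : ℝ}, a ≤ v₁ → v₁ ≤ b → 0 ≤ v₂ → v₂ ≤ T →
      ‖(θ' - θ) v₁ v₂‖ ≤ 2 * (1 + T) ^ 3 * (X + D + Y) := fun i j k l =>
    calc _ ≤ _ := h.sup_diff hE i j k l
      _ ≤ 2 * (1 + T) ^ 2 * ((1 + T) * (X + D + Y)) := by gcongr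
      _ = _ := by ring
  have hψs := hsup hs₁ hs₁b hs₂ hs₂T
  have hψu := hsup hu₁ hu₁b hu₂ hu₂T
  have hDV : D ≤ X + D + Y := by linarith
  have hYV : Y ≤ X + D + Y := by linarith
  have hV : 0 ≤ X + D + Y := by linarith
  -- The choice of where to place `η` may depend on the rectangle; the bound obtained is the same
  -- either way.
  have hmix := mixed_rpow_le (T := T) (r₁ := t₁ - s₁) (r₂ := t₂ - s₂) hE.eta_nonneg hE.eta_le
    hE.le_one₁ hE.le_one₂ hE.one_le₁ hE.one_le₂ h.one_le_M hr₁ hr₁T hr₂ hr₂T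
    (norm_nonneg (θ u₁ s₂ - θ s₁ s₂)) (norm_nonneg (θ s₁ u₂ - θ s₁ s₂))
    (hθ₁.trans (by gcongr)) (hθ₂.trans (by gcongr))
  rw [rpow_add_half hr₁ hγ₁, rpow_add_half hr₂ hγ₂]
  set W := X + D + Y
  have hψ₂'' : ‖(θ' - θ) s₁ u₂ - (θ' - θ) s₁ s₂‖ ≤ (1 + T) ^ 2 * W * (u₂ - s₂) ^ γ₂ :=
    hψ₂.trans (by
      have : 0 ≤ (u₂ - s₂) ^ γ₂ := Real.rpow_nonneg (by linarith) _
      calc _ ≤ (1 + T) * ((1 + T) * W) * (u₂ - s₂) ^ γ₂ := by gcongr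
        _ = _ := by ring)
  set x₁ := (t₁ - s₁) ^ γ₁
  set x₂ := (t₂ - s₂) ^ γ₂
  set y₁ := (t₁ - s₁) ^ (1 / 2 : ℝ)
  set y₂ := (t₂ - s₂) ^ (1 / 2 : ℝ)
  have hf' : DiffBound η (M * (x₁ * x₂)) (rectIncr A' u₁ u₂ t₁ t₂) := hf.mono (by gcongr)
  have hB' : DiffBound η (D * (x₁ * x₂)) (rectIncr (A - A') u₁ u₂ t₁ t₂) := hB.mono (by gcongr)
  rw [germSub_defect_mixed]
  have e := hf'.norm_rect_sub_le (θ s₁ s₂) (θ u₁ s₂) (θ s₁ u₂) (θ u₁ u₂) ((θ' - θ) s₁ s₂)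
    ((θ' - θ) u₁ s₂) ((θ' - θ) s₁ u₂) ((θ' - θ) u₁ u₂) hmix
  simp only [show ∀ p q, θ p q + (θ' - θ) p q = θ' p q from fun p q =>
    add_sub_cancel (θ p q) (θ' p q)] at e
  have hc₁ : ‖θ u₁ u₂ - θ u₁ s₂ - θ s₁ u₂ + θ s₁ s₂‖ ≤ M * (x₁ * x₂) :=
    hθ₁₂.trans (by gcongr)
  have hc₂ : ‖(θ' - θ) u₁ u₂ - (θ' - θ) u₁ s₂ - (θ' - θ) s₁ u₂ + (θ' - θ) s₁ s₂‖ ≤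
      W * (x₁ * x₂) := hψ₁₂.trans (by gcongr)
  calc _ ≤ D * (x₁ * x₂) * (M * (x₁ * x₂) + M * x₁ * (M * x₂))
        + M * (x₁ * x₂) * (W * (x₁ * x₂) + M * (x₁ * x₂) * (2 * (1 + T) ^ 3 * W)
          + M ^ 2 * (1 + T) * (y₁ * y₂) * (2 * (1 + T) ^ 3 * W)
          + (1 + T) * W * x₁ * (M' * x₂) + (1 + T) * W * x₁ * (M * x₂)
          + M * x₁ * ((1 + T) ^ 2 * W * x₂)) := by
        refine norm_sub_le_of_le ((hB'.norm_rect_le _ _ _ _).trans ?_) (e.trans ?_)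
        · gcongr
          · exact hθ₁.trans (by gcongr)
          · exact hθ₂.trans (by gcongr)
        · gcongr
          · exact hψ₁.trans (by gcongr)
          · exact hψ₂'.trans (by gcongr)
          · exact hψ₁.trans (by gcongr)
          · exact hθ₂.trans (by gcongr)
          · exact hθ₁.trans (by gcongr)
          · exact hψ₂''.trans (by gcongr)
    _ ≤ W * (x₁ * x₂) * (M * (x₁ * x₂) + M * x₁ * (M * x₂))
        + M * (x₁ * x₂) * (W * (x₁ * x₂) + M * (x₁ * x₂) * (2 * (1 + T) ^ 3 * W)
          + M ^ 2 * (1 + T) * (y₁ * y₂) * (2 * (1 + T) ^ 3 * W)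
          + (1 + T) * W * x₁ * (M' * x₂) + (1 + T) * W * x₁ * (M * x₂)
          + M * x₁ * ((1 + T) ^ 2 * W * x₂)) := by gcongr
    _ = W * (x₁ * x₂) * (((M + M ^ 2) + M * (1 + 2 * (1 + T) ^ 3 * M + (1 + T) * M'
          + (1 + T) * M + (1 + T) ^ 2 * M)) * (x₁ * x₂)
          + M * (2 * (1 + T) ^ 4 * M ^ 2) * (y₁ * y₂)) := by ring
    _ ≤ W * (x₁ * x₂) * (((M + M ^ 2) + M * (1 + 2 * (1 + T) ^ 3 * M + (1 + T) * M'
          + (1 + T) * M + (1 + T) ^ 2 * M)) * (((1 + T) * y₁) * ((1 + T) * y₂))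
          + M * (2 * (1 + T) ^ 4 * M ^ 2) * (y₁ * y₂)) := by gcongr
    _ = _ := by rw [mixedConst]; ring

theorem mixedConst_nonneg (hT : 0 ≤ T) (hM : 0 ≤ M) (hM' : 0 ≤ M') : 0 ≤ mixedConst T M M' := by
  rw [mixedConst]
  positivity

end StripData

end

/-! ### The local estimate and absorption on thin strips -/

section

open IntervalPartition

variable {V : Type*} [NormedAddCommGroup V]

namespace StripData

variable {η γ₁ γ₂ T a b M M' D X Y : ℝ} {A A' : ℝ → ℝ → V → V} {θ θ' : ℝ → ℝ → V}

/-- The constant in front of the data in the local estimate. -/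
noncomputable def mainConst (T γ₂ M : ℝ) : ℝ :=
  (1 + 2 * (1 + T) ^ 2 * M) + sewingConst (γ₂ + 1 / 2)
    * ((1 + T) * (M + M * ((1 + T) + 2 * (1 + T) ^ 2 * M)) * (1 + T))

/-- The constant in front of the terms that are small on thin strips in the local estimate. -/
noncomputable def smallConst (T γ₁ γ₂ M M' : ℝ) : ℝ :=
  mainConst T γ₂ M + sewingConst (γ₁ + 1 / 2) *
    ((1 + T) * (M + M * ((1 + T) + 2 * (1 + T) ^ 3 * M))
      + sewingConst (γ₂ + 1 / 2) * (mixedConst T M M' * (1 + T)))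

theorem one_le_mainConst (hT : 0 ≤ T) (hM : 0 ≤ M) (hγ₂ : 1 / 2 < γ₂) : 1 ≤ mainConst T γ₂ M := by
  have h := (sewingConst_pos (β := γ₂ + 1 / 2) (by linarith)).le
  have h1 : 0 ≤ sewingConst (γ₂ + 1 / 2)
    * ((1 + T) * (M + M * ((1 + T) + 2 * (1 + T) ^ 2 * M)) * (1 + T)) := by positivity
  have h2 : 0 ≤ 2 * (1 + T) ^ 2 * M := by positivity
  rw [mainConst]
  linarith

theorem one_le_smallConst (hT : 0 ≤ T) (hM : 0 ≤ M) (hM' : 0 ≤ M') (hγ₁ : 1 / 2 < γ₁)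
    (hγ₂ : 1 / 2 < γ₂) : 1 ≤ smallConst T γ₁ γ₂ M M' := by
  have h₁ := (sewingConst_pos (β := γ₁ + 1 / 2) (by linarith)).le
  have h₂ := (sewingConst_pos (β := γ₂ + 1 / 2) (by linarith)).le
  have h₃ := mixedConst_nonneg hT hM hM'
  have h₄ := one_le_mainConst hT hM hγ₂
  have : 0 ≤ sewingConst (γ₁ + 1 / 2) *
    ((1 + T) * (M + M * ((1 + T) + 2 * (1 + T) ^ 3 * M))
      + sewingConst (γ₂ + 1 / 2) * (mixedConst T M M' * (1 + T))) := by positivity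
  rw [smallConst]
  linarith

/-- The local estimate on a strip. -/
theorem local_rectBound (hE : Exponents η γ₁ γ₂)
    (h : StripData η γ₁ γ₂ T a b M M' D X Y A A' θ θ') (hθ : IsDyadicSolution T A θ)
    (hθ' : IsDyadicSolution T A' θ') :
    RectBound γ₁ γ₂ T a b (mainConst T γ₂ M * (X + D)
      + (b - a) ^ (1 / 2 : ℝ) * smallConst T γ₁ γ₂ M M' * (X + D + Y)) (θ' - θ) := by
  intro s₁ t₁ s₂ t₂ hs₁ hst₁ ht₁ hs₂ hst₂ ht₂
  have hT := h.T_nonneg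
  have hM : 0 ≤ M := by linarith [h.one_le_M]
  have hγ₁ : 0 ≤ γ₁ := by linarith [hE.half_lt₁]
  have hγ₂ : 0 ≤ γ₂ := by linarith [hE.half_lt₂]
  have hβ₁ : 1 < γ₁ + 1 / 2 := by linarith [hE.half_lt₁]
  have hβ₂ : 1 < γ₂ + 1 / 2 := by linarith [hE.half_lt₂]
  have hr₁ : 0 ≤ t₁ - s₁ := by linarith
  have hr₂ : 0 ≤ t₂ - s₂ := by linarith
  have hlim := (hθ (h.zero_le_left.trans hs₁) hst₁ (ht₁.trans h.le_T) hs₂ hst₂ ht₂).sub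
    (hθ' (h.zero_le_left.trans hs₁) hst₁ (ht₁.trans h.le_T) hs₂ hst₂ ht₂)
  have hlim' : Filter.Tendsto (fun n => ‖(dyadic n hst₁).sum fun u₁ v₁ =>
      (dyadic n hst₂).sum fun u₂ v₂ => germSub A A' θ θ' u₁ v₁ u₂ v₂‖)
      Filter.atTop (nhds ‖rectIncr (θ' - θ) s₁ s₂ t₁ t₂‖) := by
    have e : ‖rectIncr (θ' - θ) s₁ s₂ t₁ t₂‖ =
        ‖rectIncr θ s₁ s₂ t₁ t₂ - rectIncr θ' s₁ s₂ t₁ t₂‖ := by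
      rw [norm_sub_rev]
      congr 1
      simp only [rectIncr, Pi.sub_apply]
      abel
    rw [e]
    refine hlim.norm.congr fun n => ?_
    rw [← sum_sub]
    simp only [germSub, ← sum_sub]
  refine le_of_tendsto' hlim' fun n => ?_
  refine (norm_dyadic_sum_sum_le (Z := germSub A A' θ θ')
    (c₁ := (1 + T) * (M + M * ((1 + T) + 2 * (1 + T) ^ 3 * M)) * (X + D + Y) * (t₂ - s₂) ^ γ₂)
    (c₂ := (1 + T) * (M + M * ((1 + T) + 2 * (1 + T) ^ 2 * M))
        * (X + D + (b - a) ^ (1 / 2 : ℝ) * Y) * (t₁ - s₁) ^ γ₁)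
    (c₁₂ := mixedConst T M M' * (X + D + Y)) hβ₁ hβ₂ n n hst₁ hst₂
    (h.norm_germSub_le hE hs₁ hst₁ ht₁ hs₂ hst₂ ht₂) (fun s t hs hst ht => ?_)
    (fun s t hs hst ht => ?_) (fun s t s' t' hs hst ht hs' hst' ht' => ?_)).trans ?_
  · exact h.norm_defect_first_le hE (by linarith) (by linarith) (by linarith) (by linarith)
      hs₂ hst₂ ht₂
  · exact h.norm_defect_second_le hE hs₁ hst₁ ht₁ (by linarith) (by linarith) (by linarith)
      (by linarith)
  · exact h.norm_defect_mixed_le hE (by linarith) (by linarith) (by linarith) (by linarith)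
      (by linarith) (by linarith) (by linarith) (by linarith)
  have hy₁ : (t₁ - s₁) ^ (1 / 2 : ℝ) ≤ (b - a) ^ (1 / 2 : ℝ) :=
    Real.rpow_le_rpow hr₁ (by linarith) (by norm_num)
  have hy₂ : (t₂ - s₂) ^ (1 / 2 : ℝ) ≤ 1 + T :=
    rpow_le_one_add hr₂ (by linarith) (by norm_num) (by norm_num)
  have hx₁ : 0 ≤ (t₁ - s₁) ^ γ₁ := Real.rpow_nonneg hr₁ _
  have hx₂ : 0 ≤ (t₂ - s₂) ^ γ₂ := Real.rpow_nonneg hr₂ _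
  have hσ : 0 ≤ (b - a) ^ (1 / 2 : ℝ) := Real.rpow_nonneg (by linarith [h.left_le]) _
  have hW := h.weighted_nonneg
  have hD := h.D_nonneg
  have hX := h.X_nonneg
  have hY := h.Y_nonneg
  have hκ₁ := (sewingConst_pos hβ₁).le
  have hκ₂ := (sewingConst_pos hβ₂).le
  have hm := mixedConst_nonneg hT hM h.M'_nonneg
  have hmain : 0 ≤ mainConst T γ₂ M := zero_le_one.trans (one_le_mainConst hT hM hE.half_lt₂)
  rw [rpow_add_half hr₁ hγ₁, rpow_add_half hr₂ hγ₂]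
  have hV : 0 ≤ X + D + Y := by linarith
  -- Separates the data from `Y`, so that all of `Y` ends up behind the factor `(b - a) ^ (1 / 2)`.
  have hfin : mainConst T γ₂ M * (X + D + (b - a) ^ (1 / 2 : ℝ) * Y) ≤
      mainConst T γ₂ M * (X + D) + (b - a) ^ (1 / 2 : ℝ) * mainConst T γ₂ M * (X + D + Y) := by
    have : 0 ≤ (b - a) ^ (1 / 2 : ℝ) * mainConst T γ₂ M * (X + D) := by positivity
    linarith
  set V' := X + D + Y
  set W := X + D + (b - a) ^ (1 / 2 : ℝ) * Y
  set σ := (b - a) ^ (1 / 2 : ℝ)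
  set x₁ := (t₁ - s₁) ^ γ₁
  set x₂ := (t₂ - s₂) ^ γ₂
  set y₁ := (t₁ - s₁) ^ (1 / 2 : ℝ)
  set y₂ := (t₂ - s₂) ^ (1 / 2 : ℝ)
  set κ₁ := sewingConst (γ₁ + 1 / 2) with hκ₁'
  set κ₂ := sewingConst (γ₂ + 1 / 2) with hκ₂'
  calc _ ≤ (1 + 2 * (1 + T) ^ 2 * M) * W * (x₁ * x₂)
        + κ₂ * ((1 + T) * (M + M * ((1 + T) + 2 * (1 + T) ^ 2 * M)) * W * x₁ * (x₂ * (1 + T)))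
        + κ₁ * (((1 + T) * (M + M * ((1 + T) + 2 * (1 + T) ^ 3 * M)) * V' * x₂
          + κ₂ * (mixedConst T M M' * V' * (x₂ * (1 + T)))) * (x₁ * σ)) := by gcongr
    _ = (mainConst T γ₂ M * W + σ * (κ₁ *
          ((1 + T) * (M + M * ((1 + T) + 2 * (1 + T) ^ 3 * M))
          + κ₂ * (mixedConst T M M' * (1 + T)))) * V') * (x₁ * x₂) := by
        rw [mainConst, ← hκ₂']; ring
    _ ≤ (mainConst T γ₂ M * (X + D) + σ * mainConst T γ₂ M * V' + σ * (κ₁ *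
          ((1 + T) * (M + M * ((1 + T) + 2 * (1 + T) ^ 3 * M))
          + κ₂ * (mixedConst T M M' * (1 + T)))) * V') * (x₁ * x₂) := by gcongr
    _ = _ := by rw [smallConst, ← hκ₁', ← hκ₂']; ring

/-- On a thin strip the a priori bound disappears from the local estimate. -/
theorem rectBound_of_small (hE : Exponents η γ₁ γ₂)
    (h : StripData η γ₁ γ₂ T a b M M' D X Y A A' θ θ') (hθ : IsDyadicSolution T A θ)
    (hθ' : IsDyadicSolution T A' θ')
    (hsmall : (b - a) ^ (1 / 2 : ℝ) * smallConst T γ₁ γ₂ M M' ≤ 1 / 2) :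
    RectBound γ₁ γ₂ T a b ((2 * mainConst T γ₂ M + 1) * (X + D)) (θ' - θ) := by
  have hD := h.D_nonneg
  have hX := h.X_nonneg
  have hY := h.Y_nonneg
  have hmain : 0 ≤ mainConst T γ₂ M :=
    zero_le_one.trans (one_le_mainConst h.T_nonneg (by linarith [h.one_le_M]) hE.half_lt₂)
  -- Instead of working with the optimal `Y`, the local estimate is fed back into itself. Each pass
  -- halves the contribution of the initial `Y`, and `2 * mainConst + 1` is the fixed point of the
  -- coefficient of `X + D`.
  have key : ∀ n : ℕ, RectBound γ₁ γ₂ T a b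
      ((2 * mainConst T γ₂ M + 1) * (X + D) + Y / 2 ^ n) (θ' - θ) := by
    intro n
    induction n with
    | zero =>
      intro s₁ t₁ s₂ t₂ hs₁ hst₁ ht₁ hs₂ hst₂ ht₂
      refine (h.diff_rect hs₁ hst₁ ht₁ hs₂ hst₂ ht₂).trans ?_
      have hx₁ : 0 ≤ (t₁ - s₁) ^ γ₁ := Real.rpow_nonneg (by linarith) _
      have hx₂ : 0 ≤ (t₂ - s₂) ^ γ₂ := Real.rpow_nonneg (by linarith) _
      gcongr
      have : 0 ≤ (2 * mainConst T γ₂ M + 1) * (X + D) := by positivity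
      simpa using this
    | succ n ih =>
      have hY' : 0 ≤ (2 * mainConst T γ₂ M + 1) * (X + D) + Y / 2 ^ n := by positivity
      have h' : StripData η γ₁ γ₂ T a b M M' D X
        ((2 * mainConst T γ₂ M + 1) * (X + D) + Y / 2 ^ n) A A' θ θ' :=
        { h with Y_nonneg := hY', diff_rect := ih }
      intro s₁ t₁ s₂ t₂ hs₁ hst₁ ht₁ hs₂ hst₂ ht₂
      refine (h'.local_rectBound hE hθ hθ' hs₁ hst₁ ht₁ hs₂ hst₂ ht₂).trans ?_
      have hx₁ : 0 ≤ (t₁ - s₁) ^ γ₁ := Real.rpow_nonneg (by linarith) _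
      have hx₂ : 0 ≤ (t₂ - s₂) ^ γ₂ := Real.rpow_nonneg (by linarith) _
      refine mul_le_mul_of_nonneg_right ?_ (mul_nonneg hx₁ hx₂)
      calc _ ≤ mainConst T γ₂ M * (X + D) + 1 / 2 *
            (X + D + ((2 * mainConst T γ₂ M + 1) * (X + D) + Y / 2 ^ n)) := by gcongr
        _ = _ := by rw [pow_succ]; ring
  intro s₁ t₁ s₂ t₂ hs₁ hst₁ ht₁ hs₂ hst₂ ht₂
  have ht : Filter.Tendsto (fun n : ℕ => ((2 * mainConst T γ₂ M + 1) * (X + D) + Y / (2 : ℝ) ^ n)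
      * ((t₁ - s₁) ^ γ₁ * (t₂ - s₂) ^ γ₂)) Filter.atTop
      (nhds (((2 * mainConst T γ₂ M + 1) * (X + D) + 0)
        * ((t₁ - s₁) ^ γ₁ * (t₂ - s₂) ^ γ₂))) :=
    (tendsto_const_nhds.add (tendsto_const_nhds.div_atTop
      (tendsto_pow_atTop_atTop_of_one_lt one_lt_two))).mul_const _
  rw [add_zero] at ht
  exact ge_of_tendsto' ht fun n => key n hs₁ hst₁ ht₁ hs₂ hst₂ ht₂

end StripData

/-! ### Propagation over the whole square -/

/-- Two dyadic solutions on `[0, c] × [0, T]` with bounds on the data, on `θ`, and a crude bound on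
`θ' - θ`. -/
structure PairData (η γ₁ γ₂ T c M M' D : ℝ) (A A' : ℝ → ℝ → V → V) (θ θ' : ℝ → ℝ → V) :
    Prop where
  c_nonneg : 0 ≤ c
  le_T : c ≤ T
  one_le_M : 1 ≤ M
  M'_nonneg : 0 ≤ M'
  D_nonneg : 0 ≤ D
  driver : DriverBound η γ₁ γ₂ T M A'
  driver_sub : DriverBound η γ₁ γ₂ T D (A - A')
  first : FirstBound γ₁ T 0 c M θ
  second : SecondBound γ₂ T 0 c M θ
  rect : RectBound γ₁ γ₂ T 0 c M θ
  crude : SecondBound γ₂ T 0 c M' (θ' - θ)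
  corner : ‖(θ' - θ) 0 0‖ ≤ D
  left_edge : SecondBound γ₂ T 0 0 D (θ' - θ)
  bottom_edge : FirstBound γ₁ 0 0 c D (θ' - θ)
  diff_rect : ∃ Y, 0 ≤ Y ∧ RectBound γ₁ γ₂ T 0 c Y (θ' - θ)
  sol : IsDyadicSolution T A θ
  sol' : IsDyadicSolution T A' θ'

theorem RectBound.mono {γ₁ γ₂ T a b K K' : ℝ} {ψ : ℝ → ℝ → V} (h : RectBound γ₁ γ₂ T a b K ψ)
    (hK : K ≤ K') : RectBound γ₁ γ₂ T a b K' ψ := by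
  intro s₁ t₁ s₂ t₂ hs₁ hst₁ ht₁ hs₂ hst₂ ht₂
  refine (h hs₁ hst₁ ht₁ hs₂ hst₂ ht₂).trans ?_
  have hx₁ : 0 ≤ (t₁ - s₁) ^ γ₁ := Real.rpow_nonneg (by linarith) _
  have hx₂ : 0 ≤ (t₂ - s₂) ^ γ₂ := Real.rpow_nonneg (by linarith) _
  gcongr

theorem RectBound.restrict {γ₁ γ₂ T a b a' b' K : ℝ} {ψ : ℝ → ℝ → V}
    (h : RectBound γ₁ γ₂ T a b K ψ) (ha : a ≤ a') (hb : b' ≤ b) :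
    RectBound γ₁ γ₂ T a' b' K ψ :=
  fun _ _ _ _ hs₁ hst₁ ht₁ hs₂ hst₂ ht₂ =>
    h (ha.trans hs₁) hst₁ (ht₁.trans hb) hs₂ hst₂ ht₂

theorem FirstBound.restrict {γ₁ T a b a' b' K : ℝ} {ψ : ℝ → ℝ → V}
    (h : FirstBound γ₁ T a b K ψ) (ha : a ≤ a') (hb : b' ≤ b) : FirstBound γ₁ T a' b' K ψ :=
  fun _ _ _ hs₁ hst₁ ht₁ hs₂ hs₂T => h (ha.trans hs₁) hst₁ (ht₁.trans hb) hs₂ hs₂T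

theorem SecondBound.restrict {γ₂ T a b a' b' K : ℝ} {ψ : ℝ → ℝ → V}
    (h : SecondBound γ₂ T a b K ψ) (ha : a ≤ a') (hb : b' ≤ b) : SecondBound γ₂ T a' b' K ψ :=
  fun _ _ _ hs₁ hs₁b hs₂ hst₂ ht₂ => h (ha.trans hs₁) (hs₁b.trans hb) hs₂ hst₂ ht₂

/-- A rectangle crossing the line `b` splits there, and both widths are at most the total width. -/
theorem RectBound.join {γ₁ γ₂ T a b c K K' : ℝ} {ψ : ℝ → ℝ → V} (hγ₁ : 0 ≤ γ₁) (hK : 0 ≤ K)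
    (hK' : 0 ≤ K') (h : RectBound γ₁ γ₂ T a b K ψ) (h' : RectBound γ₁ γ₂ T b c K' ψ) :
    RectBound γ₁ γ₂ T a c (K + K') ψ := by
  intro s₁ t₁ s₂ t₂ hs₁ hst₁ ht₁ hs₂ hst₂ ht₂
  rcases le_total t₁ b with htb | hbt
  · exact h.mono (by linarith) hs₁ hst₁ htb hs₂ hst₂ ht₂
  rcases le_total b s₁ with hbs | hsb
  · exact h'.mono (by linarith) hbs hst₁ ht₁ hs₂ hst₂ ht₂
  have hx₂ : 0 ≤ (t₂ - s₂) ^ γ₂ := Real.rpow_nonneg (by linarith) _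
  have e1 : (b - s₁) ^ γ₁ ≤ (t₁ - s₁) ^ γ₁ := Real.rpow_le_rpow (by linarith) (by linarith) hγ₁
  have e2 : (t₁ - b) ^ γ₁ ≤ (t₁ - s₁) ^ γ₁ := Real.rpow_le_rpow (by linarith) (by linarith) hγ₁
  calc _ = ‖rectIncr ψ s₁ s₂ b t₂ + rectIncr ψ b s₂ t₁ t₂‖ :=
        congrArg norm (by simp only [rectIncr]; abel)
    _ ≤ K * ((b - s₁) ^ γ₁ * (t₂ - s₂) ^ γ₂) + K' * ((t₁ - b) ^ γ₁ * (t₂ - s₂) ^ γ₂) :=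
        norm_add_le_of_le (h hs₁ hsb le_rfl hs₂ hst₂ ht₂) (h' le_rfl hbt ht₁ hs₂ hst₂ ht₂)
    _ ≤ K * ((t₁ - s₁) ^ γ₁ * (t₂ - s₂) ^ γ₂) + K' * ((t₁ - s₁) ^ γ₁ * (t₂ - s₂) ^ γ₂) := by
        gcongr
    _ = _ := by ring

namespace PairData

variable {η γ₁ γ₂ T b c M M' D : ℝ} {A A' : ℝ → ℝ → V → V} {θ θ' : ℝ → ℝ → V}

theorem T_nonneg (h : PairData η γ₁ γ₂ T c M M' D A A' θ θ') : 0 ≤ T := h.c_nonneg.trans h.le_T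

theorem restrict (h : PairData η γ₁ γ₂ T c M M' D A A' θ θ') (hb : 0 ≤ b) (hbc : b ≤ c) :
    PairData η γ₁ γ₂ T b M M' D A A' θ θ' :=
  { h with
    c_nonneg := hb
    le_T := hbc.trans h.le_T
    first := h.first.restrict le_rfl hbc
    second := h.second.restrict le_rfl hbc
    rect := h.rect.restrict le_rfl hbc
    crude := h.crude.restrict le_rfl hbc
    bottom_edge := h.bottom_edge.restrict le_rfl hbc
    diff_rect := let ⟨Y, hY, hr⟩ := h.diff_rect; ⟨Y, hY, hr.restrict le_rfl hbc⟩ }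

/-- Hölder bound in the second variable from the left edge and the rectangular increments. -/
theorem secondBound (hE : Exponents η γ₁ γ₂) (h : PairData η γ₁ γ₂ T c M M' D A A' θ θ') {Y : ℝ}
    (hY : 0 ≤ Y) (hr : RectBound γ₁ γ₂ T 0 c Y (θ' - θ)) :
    SecondBound γ₂ T 0 c (D + (1 + T) * Y) (θ' - θ) := by
  intro s₁ s₂ t₂ hs₁ hs₁c hs₂ hst₂ ht₂
  have h1 := h.left_edge le_rfl le_rfl hs₂ hst₂ ht₂
  have h2 := hr le_rfl hs₁ hs₁c hs₂ hst₂ ht₂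
  have hx : 0 ≤ (t₂ - s₂) ^ γ₂ := Real.rpow_nonneg (by linarith) _
  have h3 : (s₁ - 0) ^ γ₁ ≤ 1 + T := rpow_le_one_add (by linarith) (by linarith [h.le_T])
    (by linarith [hE.half_lt₁]) hE.le_one₁
  calc _ = ‖((θ' - θ) 0 t₂ - (θ' - θ) 0 s₂) + rectIncr (θ' - θ) 0 s₂ s₁ t₂‖ :=
        congrArg norm (by simp only [rectIncr]; abel)
    _ ≤ D * (t₂ - s₂) ^ γ₂ + Y * ((s₁ - 0) ^ γ₁ * (t₂ - s₂) ^ γ₂) := norm_add_le_of_le h1 h2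
    _ ≤ D * (t₂ - s₂) ^ γ₂ + Y * ((1 + T) * (t₂ - s₂) ^ γ₂) := by gcongr
    _ = _ := by ring

/-- Hölder bound in the first variable from the bottom edge and the rectangular increments. -/
theorem firstBound (hE : Exponents η γ₁ γ₂) (h : PairData η γ₁ γ₂ T c M M' D A A' θ θ') {Y : ℝ}
    (hY : 0 ≤ Y) (hr : RectBound γ₁ γ₂ T 0 c Y (θ' - θ)) :
    FirstBound γ₁ T 0 c (D + (1 + T) * Y) (θ' - θ) := by
  intro s₁ t₁ s₂ hs₁ hst₁ ht₁ hs₂ hs₂T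
  have h1 := h.bottom_edge hs₁ hst₁ ht₁ le_rfl le_rfl
  have h2 := hr hs₁ hst₁ ht₁ le_rfl hs₂ hs₂T
  have hx : 0 ≤ (t₁ - s₁) ^ γ₁ := Real.rpow_nonneg (by linarith) _
  have h3 : (s₂ - 0) ^ γ₂ ≤ 1 + T := rpow_le_one_add (by linarith) (by linarith)
    (by linarith [hE.half_lt₂]) hE.le_one₂
  calc _ = ‖((θ' - θ) t₁ 0 - (θ' - θ) s₁ 0) + rectIncr (θ' - θ) s₁ 0 t₁ s₂‖ :=
        congrArg norm (by simp only [rectIncr]; abel)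
    _ ≤ D * (t₁ - s₁) ^ γ₁ + Y * ((t₁ - s₁) ^ γ₁ * (s₂ - 0) ^ γ₂) := norm_add_le_of_le h1 h2
    _ ≤ D * (t₁ - s₁) ^ γ₁ + Y * ((t₁ - s₁) ^ γ₁ * (1 + T)) := by gcongr
    _ = _ := by ring

/-- The growth factor of the rectangular Hölder constant over one thin strip. -/
noncomputable def extConst (T γ₂ M : ℝ) : ℝ := (2 * StripData.mainConst T γ₂ M + 1) * (4 + T)

theorem extConst_nonneg (hT : 0 ≤ T) (hM : 0 ≤ M) (hγ₂ : 1 / 2 < γ₂) : 0 ≤ extConst T γ₂ M := by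
  have := zero_le_one.trans (StripData.one_le_mainConst hT hM hγ₂)
  rw [extConst]
  positivity

/-- Extension of the estimate over one thin strip. -/
theorem extend (hE : Exponents η γ₁ γ₂) (h : PairData η γ₁ γ₂ T c M M' D A A' θ θ') {Y : ℝ}
    (hb : 0 ≤ b) (hbc : b ≤ c) (hY : 0 ≤ Y) (hr : RectBound γ₁ γ₂ T 0 b Y (θ' - θ))
    (hsmall : (c - b) ^ (1 / 2 : ℝ) * StripData.smallConst T γ₁ γ₂ M M' ≤ 1 / 2) :
    RectBound γ₁ γ₂ T 0 c (extConst T γ₂ M * (D + Y)) (θ' - θ) := by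
  have hT := h.T_nonneg
  have hD := h.D_nonneg
  have hmain : 1 ≤ StripData.mainConst T γ₂ M :=
    StripData.one_le_mainConst hT (by linarith [h.one_le_M]) hE.half_lt₂
  obtain ⟨Y₀, hY₀, hr₀⟩ := h.diff_rect
  have hTD := mul_nonneg hT hD
  have hTY := mul_nonneg hT hY
  -- The new `X` dominates both the corner bound `D + (1 + T) D` and the left-edge bound `D + (1 +
  -- T) Y` carried over from the previous strips.
  have hS : StripData η γ₁ γ₂ T b c M M' D ((2 + T) * (D + Y)) Y₀ A A' θ θ' :=
    { zero_le_left := hb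
      left_le := hbc
      le_T := h.le_T
      one_le_M := h.one_le_M
      M'_nonneg := h.M'_nonneg
      D_nonneg := hD
      X_nonneg := by positivity
      Y_nonneg := hY₀
      driver := h.driver
      driver_sub := h.driver_sub
      first := h.first.restrict hb le_rfl
      second := h.second.restrict hb le_rfl
      rect := h.rect.restrict hb le_rfl
      crude := h.crude.restrict hb le_rfl
      corner := by
        have h1 := h.bottom_edge le_rfl hb hbc le_rfl le_rfl
        have h3 : (b - 0) ^ γ₁ ≤ 1 + T := rpow_le_one_add (by linarith)
          (by linarith [h.le_T]) (by linarith [hE.half_lt₁]) hE.le_one₁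
        calc _ = ‖(θ' - θ) 0 0 + ((θ' - θ) b 0 - (θ' - θ) 0 0)‖ := congrArg norm (by abel)
          _ ≤ D + D * (b - 0) ^ γ₁ := norm_add_le_of_le h.corner h1
          _ ≤ D + D * (1 + T) := by gcongr
          _ ≤ _ := by nlinarith
      left_edge := by
        intro s₁ s₂ t₂ hs₁ hs₁b hs₂ hst₂ ht₂
        refine ((h.restrict hb hbc).secondBound hE hY hr (hb.trans hs₁) hs₁b hs₂ hst₂ ht₂).trans ?_
        have hx : 0 ≤ (t₂ - s₂) ^ γ₂ := Real.rpow_nonneg (by linarith) _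
        gcongr
        nlinarith
      bottom_edge := h.bottom_edge.restrict hb le_rfl
      diff_rect := hr₀.restrict hb le_rfl }
  have hloc := hS.rectBound_of_small hE h.sol h.sol' hsmall
  refine (hr.join (by linarith [hE.half_lt₁]) hY (by positivity) hloc).mono ?_
  have e : extConst T γ₂ M * (D + Y) = (2 * StripData.mainConst T γ₂ M + 1) * ((2 + T) * (D + Y) + D)
      + ((2 * StripData.mainConst T γ₂ M + 1) * (D + 2 * Y)) := by
    rw [extConst]; ring
  rw [e]
  have : 1 * (1 * Y) ≤ (2 * StripData.mainConst T γ₂ M + 1) * (D + 2 * Y) := by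
    gcongr <;> linarith
  linarith

/-- A number of strips that makes each of them thin. -/
noncomputable def stepCount (T γ₁ γ₂ M M' : ℝ) : ℕ :=
  ⌈4 * T * StripData.smallConst T γ₁ γ₂ M M' ^ 2⌉₊ + 1

/-- With `N ≥ 4 T S²` strips the width is at most `(1 / (2 S))²`. -/
theorem small_of_stepCount (hT : 0 ≤ T) (hM : 0 ≤ M) (hM' : 0 ≤ M') (hγ₁ : 1 / 2 < γ₁)
    (hγ₂ : 1 / 2 < γ₂) {r : ℝ} (hr : r ≤ T / stepCount T γ₁ γ₂ M M') :
    r ^ (1 / 2 : ℝ) * StripData.smallConst T γ₁ γ₂ M M' ≤ 1 / 2 := by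
  have h1 := StripData.one_le_smallConst hT hM hM' hγ₁ hγ₂
  set S := StripData.smallConst T γ₁ γ₂ M M' with hS
  have h2 : 4 * T * S ^ 2 ≤ stepCount T γ₁ γ₂ M M' := by
    rw [stepCount]
    push_cast
    linarith [Nat.le_ceil (4 * T * S ^ 2)]
  have h3 : (0 : ℝ) < stepCount T γ₁ γ₂ M M' := by
    rw [stepCount]
    positivity
  have h4 : r ≤ (1 / (2 * S)) ^ 2 := by
    refine hr.trans ?_
    rw [div_le_iff₀ h3, div_pow, one_pow, div_mul_eq_mul_div, one_mul, le_div_iff₀ (by positivity)]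
    linarith
  rw [← Real.sqrt_eq_rpow]
  calc √r * S ≤ 1 / (2 * S) * S := by
        gcongr
        exact Real.sqrt_le_iff.2 ⟨by positivity, h4⟩
    _ = 1 / 2 := by field_simp

/-- The constant after a number of thin strips, starting from zero. -/
noncomputable def iterConst (K : ℝ) : ℕ → ℝ
  | 0 => 0
  | n + 1 => K * (1 + iterConst K n)

theorem iterConst_nonneg {K : ℝ} (hK : 0 ≤ K) (n : ℕ) : 0 ≤ iterConst K n := by
  induction n with
  | zero => simp [iterConst]
  | succ n ih =>
    rw [iterConst]
    positivity

/-- The constant of the stability estimate. -/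
noncomputable def stabConst (T γ₁ γ₂ M M' : ℝ) : ℝ :=
  iterConst (extConst T γ₂ M) (stepCount T γ₁ γ₂ M M')

theorem stabConst_nonneg (hT : 0 ≤ T) (hM : 0 ≤ M) (hγ₂ : 1 / 2 < γ₂) :
    0 ≤ stabConst T γ₁ γ₂ M M' :=
  iterConst_nonneg (extConst_nonneg hT hM hγ₂) _

theorem rectBound_zero {ψ : ℝ → ℝ → V} (hγ₁ : 0 < γ₁) (K : ℝ) : RectBound γ₁ γ₂ T 0 0 K ψ := by
  intro s₁ t₁ s₂ t₂ hs₁ hst₁ ht₁ _ _ _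
  obtain rfl : s₁ = 0 := by linarith
  obtain rfl : t₁ = 0 := by linarith
  simp [rectIncr, Real.zero_rpow hγ₁.ne']

/-- The stability estimate for the rectangular increments. -/
theorem stability (hE : Exponents η γ₁ γ₂) (h : PairData η γ₁ γ₂ T c M M' D A A' θ θ') :
    RectBound γ₁ γ₂ T 0 c (stabConst T γ₁ γ₂ M M' * D) (θ' - θ) := by
  have hM : 0 ≤ M := by linarith [h.one_le_M]
  have hK := extConst_nonneg h.T_nonneg hM hE.half_lt₂
  have hc := h.c_nonneg
  have hD := h.D_nonneg
  set N := stepCount T γ₁ γ₂ M M' with hN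
  have hNpos : (0 : ℝ) < N := by
    rw [hN, stepCount]
    positivity
  have key : ∀ i ≤ N, RectBound γ₁ γ₂ T 0 (c * i / N)
      (iterConst (extConst T γ₂ M) i * D) (θ' - θ) := by
    intro i
    induction i with
    | zero =>
      intro _
      simpa using rectBound_zero (by linarith [hE.half_lt₁]) _
    | succ i ih =>
      intro hi
      have hi' : ((i + 1 : ℕ) : ℝ) ≤ N := by exact_mod_cast hi
      have hle : c * ((i + 1 : ℕ) : ℝ) / N ≤ c := by
        rw [div_le_iff₀ hNpos]
        gcongr
      have hstep : c * ((i + 1 : ℕ) : ℝ) / N - c * i / N = c / N := by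
        push_cast
        ring
      have hcN : 0 ≤ c / N := by positivity
      have hr := (h.restrict (b := c * ((i + 1 : ℕ) : ℝ) / N) (by positivity) hle).extend hE
        (b := c * i / N) (by positivity) (by linarith)
        (mul_nonneg (iterConst_nonneg hK i) hD) (ih (by omega))
        (small_of_stepCount h.T_nonneg hM h.M'_nonneg hE.half_lt₁ hE.half_lt₂ (by
          rw [hstep]
          have := h.le_T
          gcongr))
      refine hr.mono (le_of_eq ?_)
      rw [iterConst]
      ring
  have := key N le_rfl
  rwa [mul_div_cancel_right₀ _ hNpos.ne'] at this

/-- The stability estimate for close data, without an a priori bound on `θ'`. -/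
theorem stability_of_close (hE : Exponents η γ₁ γ₂)
    (h : PairData η γ₁ γ₂ T T M M' D A A' θ θ') (hD1 : D ≤ 1)
    (hD : extConst T γ₂ M * (1 + stabConst T γ₁ γ₂ M (2 + T)) * D ≤ 1) :
    RectBound γ₁ γ₂ T 0 T (stabConst T γ₁ γ₂ M (2 + T) * D) (θ' - θ) := by
  have hT := h.T_nonneg
  have hM : 0 ≤ M := by linarith [h.one_le_M]
  have hst := stabConst_nonneg (γ₁ := γ₁) (M' := 2 + T) hT hM hE.half_lt₂
  have hDn := h.D_nonneg
  -- Rectangular constant 1 gives the crude bound `D + (1 + T) ≤ 2 + T`. Rerunning `stability` with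
  -- it removes all dependence on the original `M'`.
  have reset : ∀ {b}, 0 ≤ b → b ≤ T → RectBound γ₁ γ₂ T 0 b 1 (θ' - θ) →
      RectBound γ₁ γ₂ T 0 b (stabConst T γ₁ γ₂ M (2 + T) * D) (θ' - θ) := by
    intro b hb hbT hr
    have h' := h.restrict hb hbT
    refine stability hE (M' := 2 + T) { h' with M'_nonneg := by linarith, crude := ?_ }
    intro s₁ s₂ t₂ hs₁ hs₁c hs₂ hst₂ ht₂
    refine (h'.secondBound hE zero_le_one hr hs₁ hs₁c hs₂ hst₂ ht₂).trans ?_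
    have hx : 0 ≤ (t₂ - s₂) ^ γ₂ := Real.rpow_nonneg (by linarith) _
    exact mul_le_mul_of_nonneg_right (by linarith) hx
  set N := stepCount T γ₁ γ₂ M M' with hN
  have hNpos : (0 : ℝ) < N := by
    rw [hN, stepCount]
    positivity
  have key : ∀ i ≤ N, RectBound γ₁ γ₂ T 0 (T * i / N) 1 (θ' - θ) := by
    intro i
    induction i with
    | zero =>
      intro _
      simpa using rectBound_zero (by linarith [hE.half_lt₁]) _
    | succ i ih =>
      intro hi
      have hi' : ((i + 1 : ℕ) : ℝ) ≤ N := by exact_mod_cast hi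
      have hle : T * ((i + 1 : ℕ) : ℝ) / N ≤ T := by
        rw [div_le_iff₀ hNpos]
        gcongr
      have hstep : T * ((i + 1 : ℕ) : ℝ) / N - T * i / N = T / N := by
        push_cast
        ring
      have hcN : 0 ≤ T / N := by positivity
      -- The strip width still uses the original `M'`, but the growth over one strip does not, so
      -- smallness of `D` independent of `M'` closes the induction.
      have hr := (h.restrict (b := T * ((i + 1 : ℕ) : ℝ) / N) (by positivity) hle).extend hE
        (b := T * i / N) (by positivity) (by linarith) (mul_nonneg hst hDn)
        (reset (by positivity) (by linarith) (ih (by omega)))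
        (small_of_stepCount hT hM h.M'_nonneg hE.half_lt₁ hE.half_lt₂ hstep.le)
      exact hr.mono (le_of_eq_of_le (by ring) hD)
  have := key N le_rfl
  rw [mul_div_cancel_right₀ _ hNpos.ne'] at this
  exact reset hT le_rfl this

end PairData

end

/-! ### From the extended norms to bounds on increments -/

section HolderNorm

variable {V : Type*} [AddCommGroup V] {N : V → ℝ≥0∞} {T γ₁ γ₂ K : ℝ} {f : ℝ → ℝ → V}

theorem le_ofReal_mul_of_div_le {x : ℝ≥0∞} {K r : ℝ} (hr : 0 < r)
    (h : x / ENNReal.ofReal r ≤ ENNReal.ofReal K) : x ≤ ENNReal.ofReal (K * r) := by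
  rw [ENNReal.div_le_iff (by simpa using hr) ENNReal.ofReal_ne_top, ← ENNReal.ofReal_mul' hr.le] at h
  exact h

theorem div_le_of_le_ofReal_mul {x : ℝ≥0∞} {K r : ℝ} (hr : 0 < r)
    (h : x ≤ ENNReal.ofReal (K * r)) : x / ENNReal.ofReal r ≤ ENNReal.ofReal K := by
  rw [ENNReal.div_le_iff (by simpa using hr) ENNReal.ofReal_ne_top, ← ENNReal.ofReal_mul' hr.le]
  exact h

theorem holderSeminorm10_apply_le (h : holderNorm N T γ₁ γ₂ f ≤ ENNReal.ofReal K) {s₁ t₁ s₂ : ℝ}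
    (hs₁ : 0 ≤ s₁) (hst₁ : s₁ < t₁) (ht₁ : t₁ ≤ T) (hs₂ : 0 ≤ s₂) (hs₂T : s₂ ≤ T) :
    N (f t₁ s₂ - f s₁ s₂) ≤ ENNReal.ofReal (K * (t₁ - s₁) ^ γ₁) := by
  have h' : holderSeminorm10 N T γ₁ f ≤ ENNReal.ofReal K :=
    (le_self_add.trans le_self_add).trans (le_add_self.trans h)
  simp only [holderSeminorm10, iSup_le_iff] at h'
  have := h' s₁ ⟨hs₁, hst₁.le.trans ht₁⟩ t₁ ⟨hs₁.trans hst₁.le, ht₁⟩ s₂ ⟨hs₂, hs₂T⟩ hst₁.ne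
  rw [abs_of_pos (sub_pos.2 hst₁)] at this
  exact le_ofReal_mul_of_div_le (Real.rpow_pos_of_pos (sub_pos.2 hst₁) _) this

theorem holderSeminorm01_apply_le (h : holderNorm N T γ₁ γ₂ f ≤ ENNReal.ofReal K) {s₁ s₂ t₂ : ℝ}
    (hs₁ : 0 ≤ s₁) (hs₁T : s₁ ≤ T) (hs₂ : 0 ≤ s₂) (hst₂ : s₂ < t₂) (ht₂ : t₂ ≤ T) :
    N (f s₁ t₂ - f s₁ s₂) ≤ ENNReal.ofReal (K * (t₂ - s₂) ^ γ₂) := by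
  have h' : holderSeminorm01 N T γ₂ f ≤ ENNReal.ofReal K :=
    (le_add_self.trans le_self_add).trans (le_add_self.trans h)
  simp only [holderSeminorm01, iSup_le_iff] at h'
  have := h' s₁ ⟨hs₁, hs₁T⟩ s₂ ⟨hs₂, hst₂.le.trans ht₂⟩ t₂ ⟨hs₂.trans hst₂.le, ht₂⟩ hst₂.ne
  rw [abs_of_pos (sub_pos.2 hst₂)] at this
  exact le_ofReal_mul_of_div_le (Real.rpow_pos_of_pos (sub_pos.2 hst₂) _) this

theorem holderSeminorm11_apply_le (h : holderNorm N T γ₁ γ₂ f ≤ ENNReal.ofReal K)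
    {s₁ t₁ s₂ t₂ : ℝ} (hs₁ : 0 ≤ s₁) (hst₁ : s₁ < t₁) (ht₁ : t₁ ≤ T) (hs₂ : 0 ≤ s₂)
    (hst₂ : s₂ < t₂) (ht₂ : t₂ ≤ T) :
    N (rectIncr f s₁ s₂ t₁ t₂) ≤ ENNReal.ofReal (K * ((t₁ - s₁) ^ γ₁ * (t₂ - s₂) ^ γ₂)) := by
  have h' : holderSeminorm11 N T γ₁ γ₂ f ≤ ENNReal.ofReal K := le_add_self.trans (le_add_self.trans h)
  simp only [holderSeminorm11, iSup_le_iff] at h'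
  have := h' s₁ ⟨hs₁, hst₁.le.trans ht₁⟩ s₂ ⟨hs₂, hst₂.le.trans ht₂⟩ t₁ ⟨hs₁.trans hst₁.le, ht₁⟩
    t₂ ⟨hs₂.trans hst₂.le, ht₂⟩ hst₁.ne hst₂.ne
  rw [abs_of_pos (sub_pos.2 hst₂), abs_of_pos (sub_pos.2 hst₁)] at this
  exact le_ofReal_mul_of_div_le (mul_pos (Real.rpow_pos_of_pos (sub_pos.2 hst₁) _)
    (Real.rpow_pos_of_pos (sub_pos.2 hst₂) _)) this

end HolderNorm

section PathNorm

variable {d : ℕ} {T γ₁ γ₂ K K₁ K₂ K₁₂ : ℝ} {f g : ℝ → ℝ → EuclideanSpace ℝ (Fin d)}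

theorem norm_le_of_enorm_le {x : EuclideanSpace ℝ (Fin d)} (hK : 0 ≤ K)
    (h : ‖x‖ₑ ≤ ENNReal.ofReal K) : ‖x‖ ≤ K := by
  rw [← ofReal_norm] at h
  exact (ENNReal.ofReal_le_ofReal_iff hK).1 h

theorem norm_zero_zero_le_of_pathNorm_le (hK : 0 ≤ K)
    (h : pathNorm T γ₁ γ₂ f ≤ ENNReal.ofReal K) : ‖f 0 0‖ ≤ K :=
  norm_le_of_enorm_le hK (le_self_add.trans h)

theorem firstBound_of_pathNorm_le (hγ₁ : 0 < γ₁) (hK : 0 ≤ K)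
    (h : pathNorm T γ₁ γ₂ f ≤ ENNReal.ofReal K) : FirstBound γ₁ T 0 T K f := by
  intro s₁ t₁ s₂ hs₁ hst₁ ht₁ hs₂ hs₂T
  rcases hst₁.eq_or_lt with rfl | hst₁
  · simp [Real.zero_rpow hγ₁.ne']
  · exact norm_le_of_enorm_le (mul_nonneg hK (Real.rpow_nonneg (by linarith) _))
      (holderSeminorm10_apply_le h hs₁ hst₁ ht₁ hs₂ hs₂T)

theorem secondBound_of_pathNorm_le (hγ₂ : 0 < γ₂) (hK : 0 ≤ K)
    (h : pathNorm T γ₁ γ₂ f ≤ ENNReal.ofReal K) : SecondBound γ₂ T 0 T K f := by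
  intro s₁ s₂ t₂ hs₁ hs₁T hs₂ hst₂ ht₂
  rcases hst₂.eq_or_lt with rfl | hst₂
  · simp [Real.zero_rpow hγ₂.ne']
  · exact norm_le_of_enorm_le (mul_nonneg hK (Real.rpow_nonneg (by linarith) _))
      (holderSeminorm01_apply_le h hs₁ hs₁T hs₂ hst₂ ht₂)

theorem rectBound_of_pathNorm_le (hγ₁ : 0 < γ₁) (hγ₂ : 0 < γ₂) (hK : 0 ≤ K)
    (h : pathNorm T γ₁ γ₂ f ≤ ENNReal.ofReal K) : RectBound γ₁ γ₂ T 0 T K f := by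
  intro s₁ t₁ s₂ t₂ hs₁ hst₁ ht₁ hs₂ hst₂ ht₂
  rcases hst₁.eq_or_lt with rfl | hst₁
  · simp [rectIncr, Real.zero_rpow hγ₁.ne']
  rcases hst₂.eq_or_lt with rfl | hst₂
  · simp [rectIncr, Real.zero_rpow hγ₂.ne']
  exact norm_le_of_enorm_le (mul_nonneg hK (mul_nonneg (Real.rpow_nonneg (by linarith) _)
    (Real.rpow_nonneg (by linarith) _))) (holderSeminorm11_apply_le h hs₁ hst₁ ht₁ hs₂ hst₂ ht₂)

theorem norm_rectIncr_le (h : RectBound γ₁ γ₂ T 0 T K f) {s₁ t₁ s₂ t₂ : ℝ}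
    (hs₁ : s₁ ∈ Set.Icc 0 T) (ht₁ : t₁ ∈ Set.Icc 0 T) (hs₂ : s₂ ∈ Set.Icc 0 T)
    (ht₂ : t₂ ∈ Set.Icc 0 T) :
    ‖rectIncr f s₁ s₂ t₁ t₂‖ ≤ K * (|t₁ - s₁| ^ γ₁ * |t₂ - s₂| ^ γ₂) := by
  have swap₁ : ∀ s₁ s₂ t₁ t₂, ‖rectIncr f s₁ s₂ t₁ t₂‖ = ‖rectIncr f t₁ s₂ s₁ t₂‖ := by
    intro s₁ s₂ t₁ t₂
    rw [← norm_neg]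
    congr 1
    simp only [rectIncr]
    abel
  have swap₂ : ∀ s₁ s₂ t₁ t₂, ‖rectIncr f s₁ s₂ t₁ t₂‖ = ‖rectIncr f s₁ t₂ t₁ s₂‖ := by
    intro s₁ s₂ t₁ t₂
    rw [← norm_neg]
    congr 1
    simp only [rectIncr]
    abel
  -- Exchanging the endpoints in one variable only changes the sign of the rectangular increment.
  wlog h₁ : s₁ ≤ t₁ generalizing s₁ t₁
  · rw [swap₁, abs_sub_comm t₁]
    exact this ht₁ hs₁ (le_of_not_ge h₁)
  wlog h₂ : s₂ ≤ t₂ generalizing s₂ t₂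
  · rw [swap₂, abs_sub_comm t₂]
    exact this ht₂ hs₂ (le_of_not_ge h₂)
  rw [abs_of_nonneg (sub_nonneg.2 h₁), abs_of_nonneg (sub_nonneg.2 h₂)]
  exact h hs₁.1 h₁ ht₁.2 hs₂.1 h₂ ht₂.2

theorem pathSeminorm_le (hK₁ : 0 ≤ K₁) (hK₂ : 0 ≤ K₂) (hK₁₂ : 0 ≤ K₁₂)
    (h₁ : FirstBound γ₁ T 0 T K₁ f) (h₂ : SecondBound γ₂ T 0 T K₂ f)
    (h₁₂ : RectBound γ₁ γ₂ T 0 T K₁₂ f) :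
    pathSeminorm T γ₁ γ₂ f ≤ ENNReal.ofReal (K₁ + K₂ + K₁₂) := by
  rw [ENNReal.ofReal_add (add_nonneg hK₁ hK₂) hK₁₂, ENNReal.ofReal_add hK₁ hK₂]
  refine add_le_add (add_le_add ?_ ?_) ?_
  · refine iSup₂_le fun s₁ hs₁ => iSup₂_le fun t₁ ht₁ => iSup₂_le fun s₂ hs₂ => iSup_le fun hne => ?_
    refine div_le_of_le_ofReal_mul
      (Real.rpow_pos_of_pos (abs_pos.2 (sub_ne_zero.2 hne.symm)) _) ?_
    beta_reduce
    rw [← ofReal_norm]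
    refine ENNReal.ofReal_le_ofReal ?_
    rcases le_total s₁ t₁ with h | h
    · rw [abs_of_nonneg (sub_nonneg.2 h)]
      exact h₁ hs₁.1 h ht₁.2 hs₂.1 hs₂.2
    · rw [norm_sub_rev, abs_sub_comm, abs_of_nonneg (sub_nonneg.2 h)]
      exact h₁ ht₁.1 h hs₁.2 hs₂.1 hs₂.2
  · refine iSup₂_le fun s₁ hs₁ => iSup₂_le fun s₂ hs₂ => iSup₂_le fun t₂ ht₂ => iSup_le fun hne => ?_
    refine div_le_of_le_ofReal_mul
      (Real.rpow_pos_of_pos (abs_pos.2 (sub_ne_zero.2 hne.symm)) _) ?_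
    beta_reduce
    rw [← ofReal_norm]
    refine ENNReal.ofReal_le_ofReal ?_
    rcases le_total s₂ t₂ with h | h
    · rw [abs_of_nonneg (sub_nonneg.2 h)]
      exact h₂ hs₁.1 hs₁.2 hs₂.1 h ht₂.2
    · rw [norm_sub_rev, abs_sub_comm, abs_of_nonneg (sub_nonneg.2 h)]
      exact h₂ hs₁.1 hs₁.2 ht₂.1 h hs₂.2
  · refine iSup₂_le fun s₁ hs₁ => iSup₂_le fun s₂ hs₂ => iSup₂_le fun t₁ ht₁ =>
      iSup₂_le fun t₂ ht₂ => iSup₂_le fun hne₁ hne₂ => ?_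
    refine div_le_of_le_ofReal_mul
      (mul_pos (Real.rpow_pos_of_pos (abs_pos.2 (sub_ne_zero.2 hne₁.symm)) _)
        (Real.rpow_pos_of_pos (abs_pos.2 (sub_ne_zero.2 hne₂.symm)) _)) ?_
    beta_reduce
    rw [← ofReal_norm]
    exact ENNReal.ofReal_le_ofReal (norm_rectIncr_le h₁₂ hs₁ ht₁ hs₂ ht₂)

theorem pathSeminorm_sub_comm : pathSeminorm T γ₁ γ₂ (f - g) = pathSeminorm T γ₁ γ₂ (g - f) := by
  have h1 : ∀ s t s' t', ‖(f - g) s t - (f - g) s' t'‖ₑ = ‖(g - f) s t - (g - f) s' t'‖ₑ := by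
    intro s t s' t'
    rw [← enorm_neg]
    congr 1
    simp only [Pi.sub_apply]
    abel
  have h2 : ∀ s t s' t', ‖rectIncr (f - g) s t s' t'‖ₑ = ‖rectIncr (g - f) s t s' t'‖ₑ := by
    intro s t s' t'
    rw [← enorm_neg]
    congr 1
    simp only [rectIncr, Pi.sub_apply]
    abel
  simp only [pathSeminorm, holderSeminorm, holderSeminorm10, holderSeminorm01, holderSeminorm11,
    h1, h2]

theorem pathNorm_eq : pathNorm T γ₁ γ₂ f = ‖f 0 0‖ₑ + pathSeminorm T γ₁ γ₂ f := rfl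

theorem pathNorm_sub_comm : pathNorm T γ₁ γ₂ (f - g) = pathNorm T γ₁ γ₂ (g - f) := by
  rw [pathNorm_eq, pathNorm_eq, pathSeminorm_sub_comm]
  congr 1
  exact enorm_sub_rev (f 0 0) (g 0 0)

theorem SecondBound.sub {a b K' : ℝ} (hf : SecondBound γ₂ T a b K f)
    (hg : SecondBound γ₂ T a b K' g) : SecondBound γ₂ T a b (K + K') (f - g) := by
  intro s₁ s₂ t₂ hs₁ hs₁b hs₂ hst₂ ht₂
  have := norm_sub_le_of_le (hf hs₁ hs₁b hs₂ hst₂ ht₂) (hg hs₁ hs₁b hs₂ hst₂ ht₂)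
  rw [← add_mul] at this
  refine le_of_eq_of_le (congrArg norm ?_) this
  simp only [Pi.sub_apply]
  abel

theorem RectBound.sub {a b K' : ℝ} (hf : RectBound γ₁ γ₂ T a b K f)
    (hg : RectBound γ₁ γ₂ T a b K' g) : RectBound γ₁ γ₂ T a b (K + K') (f - g) := by
  intro s₁ t₁ s₂ t₂ hs₁ hst₁ ht₁ hs₂ hst₂ ht₂
  have := norm_sub_le_of_le (hf hs₁ hst₁ ht₁ hs₂ hst₂ ht₂) (hg hs₁ hst₁ ht₁ hs₂ hst₂ ht₂)
  rw [← add_mul] at this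
  refine le_of_eq_of_le (congrArg norm ?_) this
  simp only [rectIncr, Pi.sub_apply]
  abel

end PathNorm

section Driver

variable {d : ℕ} {T γ₁ γ₂ K K' : ℝ} {A A' : ℝ → ℝ → EuclideanSpace ℝ (Fin d) →
  EuclideanSpace ℝ (Fin d)}

theorem DiffBound.zero_fun {E F : Type*} [NormedAddCommGroup E] [NormedAddCommGroup F] {η N : ℝ}
    (hN : 0 ≤ N) : DiffBound η N (0 : E → F) where
  zero _ := by simpa using hN
  one _ _ := by simp only [Pi.zero_apply, sub_zero, norm_zero]; positivity
  two _ _ _ := by simp only [Pi.zero_apply, sub_zero, add_zero, norm_zero]; positivity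
  three _ _ _ _ := by simp only [Pi.zero_apply, sub_zero, add_zero, norm_zero]; positivity

theorem driverBound_of_driverNorm_le {η : ℝ≥0} (hγ₁ : 0 < γ₁) (hγ₂ : 0 < γ₂) (hK : 0 ≤ K)
    (h : driverNorm T γ₁ γ₂ η A ≤ ENNReal.ofReal K) : DriverBound η γ₁ γ₂ T K A := by
  intro s₁ t₁ s₂ t₂ hs₁ hst₁ ht₁ hs₂ hst₂ ht₂
  rcases hst₁.eq_or_lt with rfl | hst₁
  · have : rectIncr A s₁ s₂ s₁ t₂ = 0 := by simp [rectIncr]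
    rw [this]
    exact DiffBound.zero_fun (by simp [Real.zero_rpow hγ₁.ne'])
  rcases hst₂.eq_or_lt with rfl | hst₂
  · have : rectIncr A s₁ s₂ t₁ s₂ = 0 := by simp [rectIncr]
    rw [this]
    exact DiffBound.zero_fun (by simp [Real.zero_rpow hγ₂.ne'])
  exact DiffBound.of_spaceNorm_le (mul_nonneg hK (mul_nonneg (Real.rpow_nonneg (by linarith) _)
    (Real.rpow_nonneg (by linarith) _))) (holderSeminorm11_apply_le h hs₁ hst₁ ht₁ hs₂ hst₂ ht₂)

theorem DriverBound.sub {η : ℝ} (hA : DriverBound η γ₁ γ₂ T K A)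
    (hA' : DriverBound η γ₁ γ₂ T K' A') : DriverBound η γ₁ γ₂ T (K + K') (A - A') := by
  intro s₁ t₁ s₂ t₂ hs₁ hst₁ ht₁ hs₂ hst₂ ht₂
  have := (hA hs₁ hst₁ ht₁ hs₂ hst₂ ht₂).sub (hA' hs₁ hst₁ ht₁ hs₂ hst₂ ht₂)
  rw [← add_mul] at this
  have e : rectIncr (A - A') s₁ s₂ t₁ t₂ = rectIncr A s₁ s₂ t₁ t₂ - rectIncr A' s₁ s₂ t₁ t₂ := by
    simp only [rectIncr, Pi.sub_apply]
    abel
  rw [e]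
  exact this

theorem DriverBound.mono {η : ℝ} (hA : DriverBound η γ₁ γ₂ T K A) (h : K ≤ K') :
    DriverBound η γ₁ γ₂ T K' A := by
  intro s₁ t₁ s₂ t₂ hs₁ hst₁ ht₁ hs₂ hst₂ ht₂
  refine (hA hs₁ hst₁ ht₁ hs₂ hst₂ ht₂).mono ?_
  have hx₁ : 0 ≤ (t₁ - s₁) ^ γ₁ := Real.rpow_nonneg (by linarith) _
  have hx₂ : 0 ≤ (t₂ - s₂) ^ γ₂ := Real.rpow_nonneg (by linarith) _
  gcongr

end Driver

namespace IntervalPartition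

theorem sum_add {V : Type*} [AddCommMonoid V] {a b : ℝ} (P : IntervalPartition a b)
    (Ξ Ξ' : ℝ → ℝ → V) : P.sum (fun s t => Ξ s t + Ξ' s t) = P.sum Ξ + P.sum Ξ' := by
  simp [sum, Finset.sum_add_distrib]

/-- Inclusion and exclusion over the four rectangles with lower corner `(a₁, a₂)` leaves the cells
of the upper right block. -/
theorem nlySum_append_rect {d : ℕ}
    (A : ℝ → ℝ → EuclideanSpace ℝ (Fin d) → EuclideanSpace ℝ (Fin d))
    (y : ℝ → ℝ → EuclideanSpace ℝ (Fin d)) {a₁ b₁ c₁ a₂ b₂ c₂ : ℝ}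
    (P : IntervalPartition a₁ b₁) (P' : IntervalPartition b₁ c₁)
    (Q : IntervalPartition a₂ b₂) (Q' : IntervalPartition b₂ c₂) :
    nlySum A y (P.append P') (Q.append Q') - nlySum A y (P.append P') Q
      - nlySum A y P (Q.append Q') + nlySum A y P Q =
    P'.sum fun u₁ v₁ => Q'.sum fun u₂ v₂ => rectIncr A u₁ u₂ v₁ v₂ (y u₁ u₂) := by
  have e : ∀ {a b a' b' : ℝ} (P : IntervalPartition a b) (Q : IntervalPartition a' b'),
      nlySum A y P Q = P.sum fun u₁ v₁ => Q.sum fun u₂ v₂ =>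
        rectIncr A u₁ u₂ v₁ v₂ (y u₁ u₂) := fun _ _ => rfl
  simp only [e, sum_append, sum_add]
  abel

/-- The partition of a degenerate interval without cells. -/
def empty (a : ℝ) : IntervalPartition a a where
  n := 0
  pt _ := a
  mono := monotone_const
  pt_zero := rfl
  pt_n := rfl

end IntervalPartition

/-! ### Dyadic convergence and boundary values of solutions -/

namespace IsNLYSolution

open IntervalPartition

variable {d : ℕ} {T γ₁ γ₂ : ℝ} {η : ℝ≥0}
  {A : ℝ → ℝ → EuclideanSpace ℝ (Fin d) → EuclideanSpace ℝ (Fin d)}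
  {ξ θ : ℝ → ℝ → EuclideanSpace ℝ (Fin d)}

/-- The equation concerns rectangles anchored at the origin. Using it at all four corners, with
grids that contain the lines through `s₁` and `s₂`, localizes it to an arbitrary rectangle, and `ξ`
cancels. -/
theorem isDyadicSolution (h : IsNLYSolution T γ₁ γ₂ η A ξ θ) : IsDyadicSolution T A θ := by
  intro s₁ t₁ s₂ t₂ hs₁ hst₁ ht₁ hs₂ hst₂ ht₂
  have hs₁m : s₁ ∈ Set.Icc 0 T := ⟨hs₁, hst₁.trans ht₁⟩
  have ht₁m : t₁ ∈ Set.Icc 0 T := ⟨hs₁.trans hst₁, ht₁⟩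
  have hs₂m : s₂ ∈ Set.Icc 0 T := ⟨hs₂, hst₂.trans ht₂⟩
  have ht₂m : t₂ ∈ Set.Icc 0 T := ⟨hs₂.trans hst₂, ht₂⟩
  have hξ : rectIncr ξ s₁ s₂ t₁ t₂ = 0 := by
    rcases hst₁.eq_or_lt with rfl | hlt₁
    · simp [rectIncr]
    rcases hst₂.eq_or_lt with rfl | hlt₂
    · simp [rectIncr]
    exact h.boundary_rect s₁ hs₁m s₂ hs₂m t₁ ht₁m t₂ ht₂m hlt₁ hlt₂
  rw [Metric.tendsto_atTop]
  intro ε hε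
  obtain ⟨δ₁, hδ₁, e₁⟩ := h.eqn t₁ ht₁m t₂ ht₂m (ε / 4) (by linarith)
  obtain ⟨δ₂, hδ₂, e₂⟩ := h.eqn t₁ ht₁m s₂ hs₂m (ε / 4) (by linarith)
  obtain ⟨δ₃, hδ₃, e₃⟩ := h.eqn s₁ hs₁m t₂ ht₂m (ε / 4) (by linarith)
  obtain ⟨δ₄, hδ₄, e₄⟩ := h.eqn s₁ hs₁m s₂ hs₂m (ε / 4) (by linarith)
  obtain ⟨δ, hδ, hδ₁', hδ₂', hδ₃', hδ₄'⟩ : ∃ δ > 0, δ ≤ δ₁ ∧ δ ≤ δ₂ ∧ δ ≤ δ₃ ∧ δ ≤ δ₄ :=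
    ⟨min (min δ₁ δ₂) (min δ₃ δ₄), by positivity, by simp, by simp, by simp, by simp⟩
  obtain ⟨n₁, hn₁⟩ := exists_dyadic_meshLE hs₁ hδ
  obtain ⟨n₂, hn₂⟩ := exists_dyadic_meshLE hst₁ hδ
  obtain ⟨n₃, hn₃⟩ := exists_dyadic_meshLE hs₂ hδ
  obtain ⟨n₄, hn₄⟩ := exists_dyadic_meshLE hst₂ hδ
  refine ⟨max (max n₁ n₂) (max n₃ n₄), fun n hn => ?_⟩
  simp only [ge_iff_le, max_le_iff] at hn
  have hP := hn₁ n hn.1.1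
  have hP' := hP.append (hn₂ n hn.1.2)
  have hQ := hn₃ n hn.2.1
  have hQ' := hQ.append (hn₄ n hn.2.2)
  have f₁ := e₁ _ _ (hP'.mono hδ₁') (hQ'.mono hδ₁')
  have f₂ := e₂ _ _ (hP'.mono hδ₂') (hQ.mono hδ₂')
  have f₃ := e₃ _ _ (hP.mono hδ₃') (hQ'.mono hδ₃')
  have f₄ := e₄ _ _ (hP.mono hδ₄') (hQ.mono hδ₄')
  rw [dist_eq_norm, ← nlySum_append_rect A θ (dyadic n hs₁) (dyadic n hst₁) (dyadic n hs₂)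
    (dyadic n hst₂), ← sub_zero (rectIncr θ s₁ s₂ t₁ t₂), ← hξ]
  simp only [rectIncr]
  set J₁ := nlySum A θ ((dyadic n hs₁).append (dyadic n hst₁))
    ((dyadic n hs₂).append (dyadic n hst₂))
  set J₂ := nlySum A θ ((dyadic n hs₁).append (dyadic n hst₁)) (dyadic n hs₂)
  set J₃ := nlySum A θ (dyadic n hs₁) ((dyadic n hs₂).append (dyadic n hst₂))
  set J₄ := nlySum A θ (dyadic n hs₁) (dyadic n hs₂)
  calc _ = ‖(J₁ - (θ t₁ t₂ - ξ t₁ t₂)) - (J₂ - (θ t₁ s₂ - ξ t₁ s₂)) - (J₃ - (θ s₁ t₂ - ξ s₁ t₂))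
        + (J₄ - (θ s₁ s₂ - ξ s₁ s₂))‖ := congrArg norm (by abel)
    _ ≤ ‖J₁ - (θ t₁ t₂ - ξ t₁ t₂)‖ + ‖J₂ - (θ t₁ s₂ - ξ t₁ s₂)‖ + ‖J₃ - (θ s₁ t₂ - ξ s₁ t₂)‖
        + ‖J₄ - (θ s₁ s₂ - ξ s₁ s₂)‖ :=
        norm_add_le_of_le (norm_sub_le_of_le (norm_sub_le _ _) le_rfl) le_rfl
    _ < ε := by linarith

theorem eq_of_forall_nlySum_eq_zero (h : IsNLYSolution T γ₁ γ₂ η A ξ θ) {t₁ t₂ : ℝ}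
    (ht₁ : t₁ ∈ Set.Icc 0 T) (ht₂ : t₂ ∈ Set.Icc 0 T)
    (h0 : ∀ δ > 0, ∃ (P : IntervalPartition 0 t₁) (Q : IntervalPartition 0 t₂),
      P.MeshLE δ ∧ Q.MeshLE δ ∧ nlySum A θ P Q = 0) : θ t₁ t₂ = ξ t₁ t₂ := by
  by_contra hne
  have hpos : 0 < ‖θ t₁ t₂ - ξ t₁ t₂‖ := norm_pos_iff.2 (sub_ne_zero.2 hne)
  obtain ⟨δ, hδ, e⟩ := h.eqn t₁ ht₁ t₂ ht₂ _ hpos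
  obtain ⟨P, Q, hP, hQ, hPQ⟩ := h0 δ hδ
  have := e P Q hP hQ
  rw [hPQ, zero_sub, norm_neg] at this
  exact this.false

/-- A degenerate side admits the partition without cells, whose sum is zero. Hence on the axes the
difference of two solutions is controlled by the difference of the boundary data alone. -/
theorem bottom_eq (h : IsNLYSolution T γ₁ γ₂ η A ξ θ) (hT : 0 ≤ T) {t₁ : ℝ}
    (ht₁ : t₁ ∈ Set.Icc 0 T) : θ t₁ 0 = ξ t₁ 0 := by
  refine h.eq_of_forall_nlySum_eq_zero ht₁ ⟨le_rfl, hT⟩ fun δ hδ => ?_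
  obtain ⟨n, hn⟩ := exists_dyadic_meshLE ht₁.1 hδ
  exact ⟨dyadic n ht₁.1, empty 0, hn n le_rfl, fun i hi => absurd hi (Nat.not_lt_zero i),
    by simp [nlySum, empty]⟩

theorem left_eq (h : IsNLYSolution T γ₁ γ₂ η A ξ θ) (hT : 0 ≤ T) {t₂ : ℝ}
    (ht₂ : t₂ ∈ Set.Icc 0 T) : θ 0 t₂ = ξ 0 t₂ := by
  refine h.eq_of_forall_nlySum_eq_zero ⟨le_rfl, hT⟩ ht₂ fun δ hδ => ?_
  obtain ⟨n, hn⟩ := exists_dyadic_meshLE ht₂.1 hδ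
  exact ⟨empty 0, dyadic n ht₂.1, fun i hi => absurd hi (Nat.not_lt_zero i), hn n le_rfl,
    by simp [nlySum, empty]⟩

variable {A' : ℝ → ℝ → EuclideanSpace ℝ (Fin d) → EuclideanSpace ℝ (Fin d)}
  {ξ' θ' : ℝ → ℝ → EuclideanSpace ℝ (Fin d)} {M M' D : ℝ}

/-- The size of `θ'` enters only the crude bound and the qualitative finiteness of the rectangular
constant. -/
theorem pairData (hT : 0 ≤ T) (hγ₁ : 0 < γ₁) (hγ₂ : 0 < γ₂)
    (h : IsNLYSolution T γ₁ γ₂ η A ξ θ) (h' : IsNLYSolution T γ₁ γ₂ η A' ξ' θ')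
    (hM : 1 ≤ M) (hM' : 0 ≤ M') (hD : 0 ≤ D) (hθ : pathNorm T γ₁ γ₂ θ ≤ ENNReal.ofReal M)
    (hθ' : pathNorm T γ₁ γ₂ θ' ≤ ENNReal.ofReal M') (hA' : DriverBound η γ₁ γ₂ T M A')
    (hA : driverNorm T γ₁ γ₂ η (A - A') ≤ ENNReal.ofReal D)
    (hξ : pathNorm T γ₁ γ₂ (ξ' - ξ) ≤ ENNReal.ofReal D) :
    PairData η γ₁ γ₂ T T M (M' + M) D A A' θ θ' := by
  have hM0 : 0 ≤ M := zero_le_one.trans hM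
  have h0 : (0 : ℝ) ∈ Set.Icc 0 T := ⟨le_rfl, hT⟩
  have hbot : ∀ s ∈ Set.Icc 0 T, (θ' - θ) s 0 = (ξ' - ξ) s 0 := fun s hs => by
    simp only [Pi.sub_apply, h.bottom_eq hT hs, h'.bottom_eq hT hs]
  have hleft : ∀ s ∈ Set.Icc 0 T, (θ' - θ) 0 s = (ξ' - ξ) 0 s := fun s hs => by
    simp only [Pi.sub_apply, h.left_eq hT hs, h'.left_eq hT hs]
  exact
  { c_nonneg := hT
    le_T := le_rfl
    one_le_M := hM
    M'_nonneg := by linarith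
    D_nonneg := hD
    driver := hA'
    driver_sub := driverBound_of_driverNorm_le hγ₁ hγ₂ hD hA
    first := firstBound_of_pathNorm_le hγ₁ hM0 hθ
    second := secondBound_of_pathNorm_le hγ₂ hM0 hθ
    rect := rectBound_of_pathNorm_le hγ₁ hγ₂ hM0 hθ
    crude := (secondBound_of_pathNorm_le hγ₂ hM' hθ').sub (secondBound_of_pathNorm_le hγ₂ hM0 hθ)
    corner := by
      rw [hbot 0 h0]
      exact norm_zero_zero_le_of_pathNorm_le hD hξ
    left_edge := by
      intro s₁ s₂ t₂ hs₁ hs₁0 hs₂ hst₂ ht₂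
      obtain rfl : s₁ = 0 := le_antisymm hs₁0 hs₁
      rw [hleft s₂ ⟨hs₂, hst₂.trans ht₂⟩, hleft t₂ ⟨hs₂.trans hst₂, ht₂⟩]
      exact secondBound_of_pathNorm_le hγ₂ hD hξ le_rfl hT hs₂ hst₂ ht₂
    bottom_edge := by
      intro s₁ t₁ s₂ hs₁ hst₁ ht₁ hs₂ hs₂0
      obtain rfl : s₂ = 0 := le_antisymm hs₂0 hs₂
      rw [hbot s₁ ⟨hs₁, hst₁.trans ht₁⟩, hbot t₁ ⟨hs₁.trans hst₁, ht₁⟩]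
      exact firstBound_of_pathNorm_le hγ₁ hD hξ hs₁ hst₁ ht₁ le_rfl hT
    diff_rect := ⟨M' + M, by linarith, (rectBound_of_pathNorm_le hγ₁ hγ₂ hM' hθ').sub
      (rectBound_of_pathNorm_le hγ₁ hγ₂ hM0 hθ)⟩
    sol := h.isDyadicSolution
    sol' := h'.isDyadicSolution }

end IsNLYSolution

theorem PairData.pathSeminorm_le {d : ℕ} {η γ₁ γ₂ T M M' D Y : ℝ}
    {A A' : ℝ → ℝ → EuclideanSpace ℝ (Fin d) → EuclideanSpace ℝ (Fin d)}
    {θ θ' : ℝ → ℝ → EuclideanSpace ℝ (Fin d)} (hE : Exponents η γ₁ γ₂)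
    (h : PairData η γ₁ γ₂ T T M M' D A A' θ θ') (hY : 0 ≤ Y)
    (hr : RectBound γ₁ γ₂ T 0 T (Y * D) (θ' - θ)) :
    pathSeminorm T γ₁ γ₂ (θ - θ') ≤ ENNReal.ofReal ((2 + (3 + 2 * T) * Y) * D) := by
  have hD := h.D_nonneg
  have hT := h.T_nonneg
  have hYD := mul_nonneg hY hD
  rw [pathSeminorm_sub_comm]
  refine (_root_.pathSeminorm_le (by positivity) (by positivity) hYD (h.firstBound hE hYD hr)
    (h.secondBound hE hYD hr) hr).trans (ENNReal.ofReal_le_ofReal (le_of_eq ?_))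
  ring

/-! ### The stability estimate and continuity of the solution map -/

theorem proposition3p4 (T γ₁ γ₂ : ℝ) (hT : 0 < T)
    (hγ₁ : γ₁ ∈ Set.Ioc (1 / 2 : ℝ) 1) (hγ₂ : γ₂ ∈ Set.Ioc (1 / 2 : ℝ) 1) :
    -- the stability estimate, with a constant depending only on `γ`, `M`, `T`
    (∀ M : ℝ≥0, ∃ C : ℝ≥0, ∀ (d : ℕ) (η : ℝ≥0), 0 < η → η < 1 →
      1 < (1 + (η : ℝ)) * γ₁ → 1 < (1 + (η : ℝ)) * γ₂ →
      ∀ (A A' : ℝ → ℝ → EuclideanSpace ℝ (Fin d) → EuclideanSpace ℝ (Fin d))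
        (ξ ξ' θ θ' : ℝ → ℝ → EuclideanSpace ℝ (Fin d)),
        IsNLYSolution T γ₁ γ₂ η A ξ θ → IsNLYSolution T γ₁ γ₂ η A' ξ' θ' →
        pathNorm T γ₁ γ₂ θ ≤ M → pathNorm T γ₁ γ₂ θ' ≤ M →
        driverNorm T γ₁ γ₂ η A ≤ M → driverNorm T γ₁ γ₂ η A' ≤ M →
        pathSeminorm T γ₁ γ₂ (θ - θ') ≤
          C * (pathNorm T γ₁ γ₂ (ξ - ξ') + driverNorm T γ₁ γ₂ η (A - A'))) ∧
    -- continuity of the solution map `(A, ξ) ↦ θ` at every point where a solution exists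
    (∀ (d : ℕ) (η : ℝ≥0), 0 < η → η < 1 →
      1 < (1 + (η : ℝ)) * γ₁ → 1 < (1 + (η : ℝ)) * γ₂ →
      ∀ (A : ℝ → ℝ → EuclideanSpace ℝ (Fin d) → EuclideanSpace ℝ (Fin d))
        (ξ θ : ℝ → ℝ → EuclideanSpace ℝ (Fin d)), IsNLYSolution T γ₁ γ₂ η A ξ θ →
      ∀ ε : ℝ≥0∞, 0 < ε → ∃ δ : ℝ≥0∞, 0 < δ ∧
        ∀ (A' : ℝ → ℝ → EuclideanSpace ℝ (Fin d) → EuclideanSpace ℝ (Fin d))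
          (ξ' θ' : ℝ → ℝ → EuclideanSpace ℝ (Fin d)), IsNLYSolution T γ₁ γ₂ η A' ξ' θ' →
          driverNorm T γ₁ γ₂ η (A - A') + pathNorm T γ₁ γ₂ (ξ - ξ') < δ →
          pathNorm T γ₁ γ₂ (θ - θ') < ε) := by
  have hγ₁0 : 0 < γ₁ := by linarith [hγ₁.1]
  have hγ₂0 : 0 < γ₂ := by linarith [hγ₂.1]
  have hexp : ∀ η : ℝ≥0, η < 1 → 1 < (1 + (η : ℝ)) * γ₁ → 1 < (1 + (η : ℝ)) * γ₂ →
      Exponents η γ₁ γ₂ := fun η hη h₁ h₂ =>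
    ⟨η.2, by exact_mod_cast hη.le, hγ₁.1, hγ₁.2, hγ₂.1, hγ₂.2, h₁.le, h₂.le⟩
  constructor
  · intro M
    -- `M + 1` replaces `M` because the mixed estimate needs a bound at least 1, to dominate `M ^ η`
    -- by `M`.
    have hM1 : (1 : ℝ) ≤ M + 1 := by simp
    have hMle : ∀ {x : ℝ≥0∞}, x ≤ M → x ≤ ENNReal.ofReal (M + 1) := fun hx =>
      hx.trans (by
        rw [← ENNReal.ofReal_coe_nnreal]
        exact ENNReal.ofReal_le_ofReal (by simp))
    set S := PairData.stabConst T γ₁ γ₂ (M + 1) ((M + 1) + (M + 1)) with hS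
    have hS0 : 0 ≤ S := PairData.stabConst_nonneg hT.le (by positivity) hγ₂.1
    refine ⟨(2 + (3 + 2 * T) * S).toNNReal, ?_⟩
    intro d η _ hη₁ hη₂ hη₃ A A' ξ ξ' θ θ' h h' hθ hθ' hA hA'
    have hE := hexp η hη₁ hη₂ hη₃
    have hC : 0 < 2 + (3 + 2 * T) * S := by positivity
    -- At infinite distance the claim is trivial because the constant is positive.
    rcases eq_or_ne (pathNorm T γ₁ γ₂ (ξ - ξ') + driverNorm T γ₁ γ₂ η (A - A')) ⊤ with htop | htop
    · rw [htop, ENNReal.mul_top (by simpa using hC)]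
      exact le_top
    set D := (pathNorm T γ₁ γ₂ (ξ - ξ') + driverNorm T γ₁ γ₂ η (A - A')).toReal with hD
    have hDe : pathNorm T γ₁ γ₂ (ξ - ξ') + driverNorm T γ₁ γ₂ η (A - A') = ENNReal.ofReal D :=
      (ENNReal.ofReal_toReal htop).symm
    have hpair := IsNLYSolution.pairData (D := D) hT.le hγ₁0 hγ₂0 h h' hM1 (by positivity)
      ENNReal.toReal_nonneg (hMle hθ) (hMle hθ')
      (driverBound_of_driverNorm_le hγ₁0 hγ₂0 (by positivity) (hMle hA'))
      (hDe ▸ le_add_self) (by rw [pathNorm_sub_comm]; exact hDe ▸ le_self_add)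
    refine (hpair.pathSeminorm_le hE hS0 (hpair.stability hE)).trans (le_of_eq ?_)
    rw [hDe, ENNReal.ofReal_mul hC.le]
    rfl
  · intro d η _ hη₁ hη₂ hη₃ A ξ θ h ε hε
    have hE := hexp η hη₁ hη₂ hη₃
    obtain ⟨e, he, hee⟩ : ∃ e : ℝ, 0 < e ∧ ENNReal.ofReal e ≤ ε := by
      refine ⟨(min ε 1).toReal, ENNReal.toReal_pos (by simp [hε.ne']) (by simp), ?_⟩
      rw [ENNReal.ofReal_toReal (by simp)]
      exact min_le_left _ _
    set a := (pathNorm T γ₁ γ₂ θ).toReal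
    set b := (driverNorm T γ₁ γ₂ η A).toReal
    have ha : 0 ≤ a := ENNReal.toReal_nonneg
    have hb : 0 ≤ b := ENNReal.toReal_nonneg
    have haθ : pathNorm T γ₁ γ₂ θ ≤ ENNReal.ofReal (a + b + 1) := by
      rw [← ENNReal.ofReal_toReal h.sol_mem.ne]
      exact ENNReal.ofReal_le_ofReal (by linarith)
    have hbA : DriverBound η γ₁ γ₂ T b A := driverBound_of_driverNorm_le hγ₁0 hγ₂0 hb
      (ENNReal.ofReal_toReal h.driver_mem.ne).ge
    -- `a + b + 1` bounds `θ`, is at least 1, and also bounds `A'`, whose rectangular constant is at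
    -- most `b + D` with `D ≤ 1`.
    have hm : 1 ≤ a + b + 1 := by linarith
    set m := a + b + 1
    have hm0 : 0 ≤ m := by linarith
    set S := PairData.stabConst T γ₁ γ₂ m (2 + T)
    have hS0 : 0 ≤ S := PairData.stabConst_nonneg hT.le hm0 hγ₂.1
    have hK0 := PairData.extConst_nonneg hT.le hm0 hγ₂.1
    set K := PairData.extConst T γ₂ m
    -- The first entry gives `D ≤ 1` and the bootstrap condition `K (1 + S) D ≤ 1`; the second makes
    -- the final norm, corner included, less than `e`. Neither refers to `θ'`.
    set r := min (1 / (1 + K * (1 + S))) (e / (3 + (3 + 2 * T) * S)) with hr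
    have hr0 : 0 < r := by positivity
    refine ⟨ENNReal.ofReal r, ENNReal.ofReal_pos.2 hr0, ?_⟩
    intro A' ξ' θ' h' hlt
    set D := (driverNorm T γ₁ γ₂ η (A - A') + pathNorm T γ₁ γ₂ (ξ - ξ')).toReal
    have hDe : driverNorm T γ₁ γ₂ η (A - A') + pathNorm T γ₁ γ₂ (ξ - ξ') = ENNReal.ofReal D :=
      (ENNReal.ofReal_toReal hlt.ne_top).symm
    have hD0 : 0 ≤ D := ENNReal.toReal_nonneg
    have hDr : D < r := by
      rw [hDe] at hlt
      exact (ENNReal.ofReal_lt_ofReal_iff hr0).1 hlt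
    have hD₁ : (1 + K * (1 + S)) * D ≤ 1 := by
      have := hDr.le.trans (min_le_left _ _)
      rw [le_div_iff₀ (by positivity)] at this
      linarith
    have hD₂ : (3 + (3 + 2 * T) * S) * D < e := by
      have := hDr.trans_le (min_le_right _ _)
      rw [lt_div_iff₀ (by positivity)] at this
      linarith
    have hKSD : 0 ≤ K * (1 + S) * D := by positivity
    have hdA : driverNorm T γ₁ γ₂ η (A - A') ≤ ENNReal.ofReal D := hDe ▸ le_self_add
    have hA' : DriverBound η γ₁ γ₂ T m A' := by
      have := hbA.sub (driverBound_of_driverNorm_le hγ₁0 hγ₂0 hD0 hdA)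
      rw [sub_sub_cancel] at this
      exact this.mono (by linarith)
    have hpair := IsNLYSolution.pairData (D := D) hT.le hγ₁0 hγ₂0 h h' hm
      ENNReal.toReal_nonneg hD0 haθ (ENNReal.ofReal_toReal h'.sol_mem.ne).ge hA' hdA
      (by rw [pathNorm_sub_comm]; exact hDe ▸ le_add_self)
    have hsemi := hpair.pathSeminorm_le hE hS0
      (hpair.stability_of_close hE (by linarith) (by linarith))
    have hcorner : ‖(θ - θ') 0 0‖ₑ ≤ ENNReal.ofReal D := by
      rw [← ofReal_norm]
      refine ENNReal.ofReal_le_ofReal (le_of_eq_of_le ?_ hpair.corner)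
      exact norm_sub_rev (θ 0 0) (θ' 0 0)
    rw [pathNorm_eq]
    calc _ ≤ ENNReal.ofReal D + ENNReal.ofReal ((2 + (3 + 2 * T) * S) * D) :=
          add_le_add hcorner hsemi
      _ = ENNReal.ofReal ((3 + (3 + 2 * T) * S) * D) := by
          rw [← ENNReal.ofReal_add hD0 (by positivity)]
          congr 1
          ring
      _ < ENNReal.ofReal e := (ENNReal.ofReal_lt_ofReal_iff he).2 hD₂
      _ ≤ ε := hee
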